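/- **Theorem (Reissner–Mindlin power balance, Stokes–Lagrange case).** Let $\Omega\subset\mathbb R^2$ be a bounded open set with Lipschitz boundary, outward unit normal $\bm n$ and arc-length measure $\mathrm ds$ on $\partial\Omega$. Let $\rho,h,k,G$ be measurable coefficients on $\Omega$ that are bounded and bounded below by positive constants, and let $\mathbb D$ be a bounded measurable field of fourth-order tensors with $\mathbb D_{ijlm}=\mathbb D_{jilm}=\mathbb D_{lmij}$. With $\operatorname{Grad}\bm\phi=\frac12(\nabla\bm\phi+\nabla\bm\phi^\top)$, put, for $w\in H^1(\Omega)$, $p_w\in L^2(\Omega)$, $\bm\phi\in H^1(\Omega)^2$, $\bm p_\phi\in L^2(\Omega)^2$, $$H^{SL}_{RM}(w,p_w,\bm\phi,\bm p_\phi)=\frac12\int_\Omega\Big(\frac{1}{\rho h}p_w^2+\frac{12}{\rho h^3}|\bm p_\phi|^2+kGh\,|\operatorname{grad}w-\bm\phi|^2+\operatorname{Grad}\bm\phi:\mathbb D\operatorname{Grad}\bm\phi\Big)\,\mathrm dx .$$ Let $I\subset\mathbb R$ be a time interval and let $t\mapsto(w,p_w,\bm\phi,\bm p_\phi)(t)$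 be differentiable on $I$ with values in $H^1(\Omega)\times L^2(\Omega)\times H^1(\Omega)^2\times L^2(\Omega)^2$, and suppose that at each $t\in I$ the variational derivatives of $H=H^{SL}_{RM}$ (with respect to test functions in $C_c^\infty(\Omega)$ and the $L^2$ pairing) exist in $L^2$ and $$\partial_t w=\delta_{p_w}H,\qquad \partial_t p_w=-\delta_wH,\qquad \partial_t\bm\phi=\delta_{\bm p_\phi}H,\qquad \partial_t\bm p_\phi=-\delta_{\bm\phi}H .$$ Suppose also that $kGh(\operatorname{grad}w-\bm\phi)\in H^1(\Omega)^2$ and $\mathbb D\operatorname{Grad}\bm\phi\in H^1(\Omega)^{2\times2}$ for each $t\in I$. Define the boundary energy ports by the traces $$\chi_1=w|_{\partial\Omega},\quad \chi_2=\bm\phi|_{\partial\Omega},\qquad \varepsilon_1=kGh(\operatorname{grad}w-\bm\phi)|_{\partial\Omega}\cdot\bm n,\quad \varepsilon_2=(\mathbb D\operatorname{Grad}\bm\phi)|_{\partial\Omega}\,\bm n .$$ Then, for each $t\in I$, $\chi=(\chi_1,\chi_2)$ is differentiable at $t$ in $L^2(\partial\Omega)^3$ with $\partial_t\chi_1=(\partial_tw)|_{\partial\Omega}$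 and $\partial_t\chi_2=(\partial_t\bm\phi)|_{\partial\Omega}$, the function $\partial_t\chi_1\,\varepsilon_1+\partial_t\chi_2^\top\varepsilon_2$ is integrable on $\partial\Omega$, the Hamiltonian is differentiable along the trajectory at $t$, and $$\frac{\mathrm d}{\mathrm dt}H^{SL}_{RM}=\int_{\partial\Omega}\partial_t w\;kGh(\operatorname{grad}w-\bm\phi)\cdot\bm n+\partial_t\bm\phi^\top\,\mathbb D\operatorname{Grad}(\bm\phi)\,\bm n\;\mathrm ds .$$ (Time derivatives at an end point of $I$ are one-sided.) -/

import Mathlib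

open MeasureTheory Set Filter Topology
open scoped ContDiff

noncomputable section

namespace ReissnerMindlin

/-- The Euclidean plane that contains the mid-surface of the plate. -/
abbrev Plane : Type := EuclideanSpace ℝ (Fin 2)

/-! ### Lipschitz domains, boundary measure and outward normal -/

/-- Near each of its boundary points, `Ω` is the region strictly below the graph of a Lipschitz
function, in a suitable orthonormal frame. -/
def HasLipschitzBoundary (Ω : Set Plane) : Prop :=
  ∀ x ∈ frontier Ω, ∃ (Φ : Plane ≃ₗᵢ[ℝ] Plane) (K : NNReal) (g : ℝ → ℝ), LipschitzWith K g ∧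
    ∀ᶠ y in 𝓝 x, (y ∈ Ω ↔ Φ y 1 < g (Φ y 0))

/-- The arc-length measure on `∂Ω`: the one-dimensional Hausdorff measure restricted to it. -/
def boundaryMeasure (Ω : Set Plane) : Measure Plane :=
  (Measure.hausdorffMeasure 1).restrict (frontier Ω)

/-- The unit vector `ν` is the outward normal of `Ω` at `x`: for each `ε > 0`, all points of a
small disc around `x` that lie in the open cone `⟪ν, y - x⟫ < -ε ‖y - x‖` are in `Ω`, and all
those in the opposite cone are outside `Ω`. There is at most one such `ν`. -/
def IsOutwardUnitNormal (Ω : Set Plane) (x ν : Plane) : Prop :=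
  ‖ν‖ = 1 ∧ ∀ ε > 0, ∀ᶠ y in 𝓝 x,
    (inner ℝ ν (y - x) < -(ε * ‖y - x‖) → y ∈ Ω) ∧
    (ε * ‖y - x‖ < inner ℝ ν (y - x) → y ∉ Ω)

open Classical in
/-- The outward unit normal field of `Ω` (zero at the points where there is no normal, which form
a null set of the boundary of a Lipschitz domain). -/
def outwardNormal (Ω : Set Plane) (x : Plane) : Plane :=
  if hx : ∃ ν, IsOutwardUnitNormal Ω x ν then hx.choose else 0

/-! ### Function spaces -/

/-- `L²(Ω)`. -/
abbrev L2 (Ω : Set Plane) : Type := Lp ℝ 2 ((volume : Measure Plane).restrict Ω)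

/-- `L²(∂Ω)`. -/
abbrev L2Boundary (Ω : Set Plane) : Type := Lp ℝ 2 (boundaryMeasure Ω)

/-- The classical partial derivative `∂f/∂xᵢ`. -/
def partialDeriv (i : Fin 2) (f : Plane → ℝ) (x : Plane) : ℝ :=
  fderiv ℝ f x (EuclideanSpace.single i 1)

/-- The pair `u = (u.1, u.2)` in `L²(Ω) × L²(Ω)²` is `(f, ∇f)`. -/
def IsJetOf (Ω : Set Plane) (u : L2 Ω × (Fin 2 → L2 Ω)) (f : Plane → ℝ) : Prop :=
  (u.1 : Plane → ℝ) =ᵐ[volume.restrict Ω] f ∧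
    ∀ i, (u.2 i : Plane → ℝ) =ᵐ[volume.restrict Ω] partialDeriv i f

/-- The pairs `(f, ∇f)` in `L²(Ω) × L²(Ω)²`, where `f` is smooth up to the boundary of `Ω`, that
is, the restriction of a smooth function on the plane. -/
def smoothJets (Ω : Set Plane) : Submodule ℝ (L2 Ω × (Fin 2 → L2 Ω)) where
  carrier := {u | ∃ f : Plane → ℝ, ContDiff ℝ ∞ f ∧ IsJetOf Ω u f}
  add_mem' := by
    rintro u v ⟨f, hf, hu, hu'⟩ ⟨g, hg, hv, hv'⟩
    refine ⟨f + g, hf.add hg, ?_, fun i => ?_⟩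
    · exact (Lp.coeFn_add u.1 v.1).trans (hu.add hv)
    · have h : partialDeriv i (f + g) = partialDeriv i f + partialDeriv i g := by
        funext x
        have hfx : DifferentiableAt ℝ f x := hf.differentiable (by simp) x
        have hgx : DifferentiableAt ℝ g x := hg.differentiable (by simp) x
        simp [partialDeriv, fderiv_add hfx hgx]
      rw [h]
      exact (Lp.coeFn_add (u.2 i) (v.2 i)).trans ((hu' i).add (hv' i))
  zero_mem' := by
    refine ⟨0, contDiff_const, Lp.coeFn_zero ℝ 2 _, fun i => ?_⟩
    have h : partialDeriv i (0 : Plane → ℝ) = 0 := by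
      funext x
      simp [partialDeriv]
    rw [h]
    exact Lp.coeFn_zero ℝ 2 _
  smul_mem' := by
    rintro c u ⟨f, hf, hu, hu'⟩
    refine ⟨c • f, hf.const_smul c, ?_, fun i => ?_⟩
    · exact (Lp.coeFn_smul c u.1).trans (hu.const_smul c)
    · have h : partialDeriv i (c • f) = c • partialDeriv i f := by
        funext x
        have hfx : DifferentiableAt ℝ f x := hf.differentiable (by simp) x
        simp [partialDeriv, fderiv_const_smul hfx]
      rw [h]
      exact (Lp.coeFn_smul c (u.2 i)).trans ((hu' i).const_smul c)

/-- The Sobolev space `H¹(Ω)` of a bounded Lipschitz domain: the closure of the functions that are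
smooth up to the boundary, for the norm of `(u, ∇u)` in `L²(Ω) × L²(Ω)²`. An element is recorded
together with its (weak) gradient, and the topology is that of the `H¹` norm. -/
abbrev H1 (Ω : Set Plane) : Type := (smoothJets Ω).topologicalClosure

/-- The function underlying an element of `H¹(Ω)`. -/
def H1.val {Ω : Set Plane} (u : H1 Ω) : L2 Ω := (u : L2 Ω × (Fin 2 → L2 Ω)).1

/-- The partial derivative `∂u/∂xᵢ` in `L²(Ω)` of `u` in `H¹(Ω)`. -/
def H1.partial {Ω : Set Plane} (u : H1 Ω) (i : Fin 2) : L2 Ω := (u : L2 Ω × (Fin 2 → L2 Ω)).2 i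

/-- `τ` in `L²(∂Ω)` is the boundary trace of `u` in `H¹(Ω)`: the pair `(u, τ)` is a limit, in
`H¹(Ω) × L²(∂Ω)`, of pairs `(f, f|∂Ω)` with `f` smooth up to the boundary. -/
def IsTrace (Ω : Set Plane) (u : H1 Ω) (τ : L2Boundary Ω) : Prop :=
  (u, τ) ∈ closure {q : H1 Ω × L2Boundary Ω | ∃ f : Plane → ℝ, ContDiff ℝ ∞ f ∧
    IsJetOf Ω q.1 f ∧ (q.2 : Plane → ℝ) =ᵐ[boundaryMeasure Ω] f}

open Classical in
/-- The trace operator `H¹(Ω) → L²(∂Ω)`. On a bounded Lipschitz domain each `u` has exactly one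
trace. -/
def trace {Ω : Set Plane} (u : H1 Ω) : L2Boundary Ω :=
  if hu : ∃ τ, IsTrace Ω u τ then hu.choose else 0

/-- `f` is (represented by) a smooth function with compact support in `Ω`. -/
def IsTestFunction {Ω : Set Plane} (f : L2 Ω) : Prop :=
  ∃ η : Plane → ℝ, ContDiff ℝ ∞ η ∧ HasCompactSupport η ∧ tsupport η ⊆ Ω ∧
    (f : Plane → ℝ) =ᵐ[volume.restrict Ω] η

/-! ### The plate -/

/-- A positive material coefficient on `Ω`: measurable, bounded, bounded away from zero. -/
def IsCoefficient (Ω : Set Plane) (c : Plane → ℝ) : Prop :=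
  AEMeasurable c (volume.restrict Ω) ∧ ∃ m M : ℝ, 0 < m ∧ ∀ x ∈ Ω, m ≤ c x ∧ c x ≤ M

/-- Density `ρ`, thickness `h`, correction factor `k`, shear modulus `G`, and the components
`D x i j l m` of the bending stiffness, a bounded field of fourth-order tensors with the usual
minor and major symmetries. -/
structure PlateParameters (Ω : Set Plane) where
  ρ : Plane → ℝ
  h : Plane → ℝ
  k : Plane → ℝ
  G : Plane → ℝ
  D : Plane → Fin 2 → Fin 2 → Fin 2 → Fin 2 → ℝ
  hρ : IsCoefficient Ω ρ
  hh : IsCoefficient Ω h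
  hk : IsCoefficient Ω k
  hG : IsCoefficient Ω G
  D_meas : ∀ i j l m, AEMeasurable (fun x => D x i j l m) (volume.restrict Ω)
  D_bound : ∃ C : ℝ, ∀ x ∈ Ω, ∀ i j l m, |D x i j l m| ≤ C
  D_minor : ∀ x ∈ Ω, ∀ i j l m, D x i j l m = D x j i l m
  D_major : ∀ x ∈ Ω, ∀ i j l m, D x i j l m = D x l m i j

/-- The state `(w, p_w, φ, p_φ)`: displacement, linear momentum, rotations, angular momenta. -/
structure PlateState (Ω : Set Plane) where
  w : H1 Ω
  pw : L2 Ω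
  φ : Fin 2 → H1 Ω
  pφ : Fin 2 → L2 Ω

/-- A quadruple `(e_w, e_{p_w}, e_φ, e_{p_φ})` of effort (co-state) variables. -/
structure PlateEffort (Ω : Set Plane) where
  w : L2 Ω
  pw : L2 Ω
  φ : Fin 2 → L2 Ω
  pφ : Fin 2 → L2 Ω

variable {Ω : Set Plane}

/-- The shear deformation `(grad w - φ)ᵢ`. -/
def shearStrain (a : PlateState Ω) (i : Fin 2) (x : Plane) : ℝ :=
  a.w.partial i x - (a.φ i).val x

/-- The symmetric gradient `Grad(φ)ᵢⱼ = (∂ᵢφⱼ + ∂ⱼφᵢ) / 2`. -/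
def symGrad (φ : Fin 2 → H1 Ω) (i j : Fin 2) (x : Plane) : ℝ :=
  ((φ j).partial i x + (φ i).partial j x) / 2

/-- The shear force `(kGh (grad w - φ))ᵢ`. -/
def shearForce (P : PlateParameters Ω) (a : PlateState Ω) (i : Fin 2) (x : Plane) : ℝ :=
  P.k x * P.G x * P.h x * shearStrain a i x

/-- The bending moment `(𝔻 Grad(φ))ᵢⱼ`. -/
def bendingMoment (P : PlateParameters Ω) (a : PlateState Ω) (i j : Fin 2) (x : Plane) : ℝ :=
  ∑ l, ∑ m, P.D x i j l m * symGrad a.φ l m x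

/-- The Hamiltonian of the plate as a functional of `(w, p_w, φ, p_φ)`. -/
def hamiltonian (P : PlateParameters Ω) (a : PlateState Ω) : ℝ :=
  (1 / 2) * ∫ x in Ω,
    (1 / (P.ρ x * P.h x) * (a.pw x) ^ 2
      + 12 / (P.ρ x * (P.h x) ^ 3) * (∑ i, (a.pφ i x) ^ 2)
      + P.k x * P.G x * P.h x * (∑ i, (shearStrain a i x) ^ 2)
      + ∑ i, ∑ j, symGrad a.φ i j x * bendingMoment P a i j x)

/-- `e` consists of the variational derivatives `(δ_w H, δ_{p_w} H, δ_φ H, δ_{p_φ} H)` of the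
functional `H` at `a`: for each component and each direction `f` that is a test function,
`H(a + s f) = H(a) + s ⟨e, f⟩ + o(s)` with the `L²` pairing. -/
structure IsVariationalDerivative (H : PlateState Ω → ℝ) (a : PlateState Ω) (e : PlateEffort Ω) :
    Prop where
  w : ∀ f : H1 Ω, IsTestFunction f.val →
    HasDerivAt (fun s : ℝ => H { a with w := a.w + s • f }) (inner ℝ e.w f.val) 0
  pw : ∀ f : L2 Ω, IsTestFunction f →
    HasDerivAt (fun s : ℝ => H { a with pw := a.pw + s • f }) (inner ℝ e.pw f) 0
  φ : ∀ f : Fin 2 → H1 Ω, (∀ i, IsTestFunction (f i).val) →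
    HasDerivAt (fun s : ℝ => H { a with φ := a.φ + s • f }) (∑ i, inner ℝ (e.φ i) (f i).val) 0
  pφ : ∀ f : Fin 2 → L2 Ω, (∀ i, IsTestFunction (f i)) →
    HasDerivAt (fun s : ℝ => H { a with pφ := a.pφ + s • f }) (∑ i, inner ℝ (e.pφ i) (f i)) 0

/-- `v` is the time derivative at `t`, within the time interval `I`, of the trajectory `a`, in the
state space `H¹(Ω) × L²(Ω) × H¹(Ω)² × L²(Ω)²`. -/
structure HasTimeDerivWithinAt (a : ℝ → PlateState Ω) (v : PlateState Ω) (I : Set ℝ) (t : ℝ) :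
    Prop where
  w : HasDerivWithinAt (fun s => (a s).w) v.w I t
  pw : HasDerivWithinAt (fun s => (a s).pw) v.pw I t
  φ : HasDerivWithinAt (fun s => (a s).φ) v.φ I t
  pφ : HasDerivWithinAt (fun s => (a s).pφ) v.pφ I t

/-- The equation `v = J e` of the plate, where `J` has the rows `(0, 1, 0, 0)`, `(-1, 0, 0, 0)`,
`(0, 0, 0, 1)`, `(0, 0, -1, 0)`. -/
structure IsStructureRelation (v : PlateState Ω) (e : PlateEffort Ω) : Prop where
  w : v.w.val = e.pw
  pw : v.pw = -e.w
  φ : ∀ i, (v.φ i).val = e.pφ i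
  pφ : ∀ i, v.pφ i = -e.φ i

/-- The trajectory `a`, with time derivative `adot`, solves the plate dynamics in Stokes-Lagrange
form `∂ₜ a = J δH(a)` on the time interval `I`. -/
def IsSolution (P : PlateParameters Ω) (I : Set ℝ) (a adot : ℝ → PlateState Ω) : Prop :=
  ∀ t ∈ I, HasTimeDerivWithinAt a (adot t) I t ∧
    ∃ e : PlateEffort Ω, IsVariationalDerivative (hamiltonian P) (a t) e ∧
      IsStructureRelation (adot t) e

/-- The vector field `N` in `H¹(Ω)²` is the shear force `kGh (grad w - φ)` of the state `a`. -/
def IsShearForce (P : PlateParameters Ω) (a : PlateState Ω) (N : Fin 2 → H1 Ω) : Prop :=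
  ∀ i, ((N i).val : Plane → ℝ) =ᵐ[volume.restrict Ω] shearForce P a i

/-- The tensor field `M` in `H¹(Ω)²ˣ²` is the bending moment `𝔻 Grad(φ)` of the state `a`. -/
def IsBendingMoment (P : PlateParameters Ω) (a : PlateState Ω) (M : Fin 2 → Fin 2 → H1 Ω) : Prop :=
  ∀ i j, ((M i j).val : Plane → ℝ) =ᵐ[volume.restrict Ω] bendingMoment P a i j

/-! ### The boundary energy ports -/

/-- The boundary displacement and rotations `χ = (w|∂Ω, φ|∂Ω)`. -/
def portDisplacement (a : PlateState Ω) : L2Boundary Ω × (Fin 2 → L2Boundary Ω) :=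
  (trace a.w, fun i => trace (a.φ i))

/-- The normal component `F · n` on `∂Ω` of the vector field `F` in `H¹(Ω)²`. -/
def normalTrace (F : Fin 2 → H1 Ω) (x : Plane) : ℝ :=
  ∑ i, trace (F i) x * outwardNormal Ω x i

end ReissnerMindlin

end

open ReissnerMindlin

namespace ReissnerMindlin

open scoped NNReal ENNReal Manifold

/-! ### Arc length of Lipschitz graphs -/

/-! The Hamiltonian is a bounded quadratic form on the state space. Along a differentiable
trajectory its derivative is therefore the polar form `energyPairing` evaluated at the state and its
velocity (`HasTimeDerivWithinAt.hamiltonian`); only the major symmetry of the stiffness tensor is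
needed there.

Write N for the shear force and M for the bending moment. Variations with compact support produce no
boundary term, so they identify the efforts: the momentum efforts are the rescaled momenta, δ_w H =
-div N and δ_φ H = -(N + Div M) (`IsVariationalDerivative.w_eq`, `IsVariationalDerivative.φ_eq`).
Substituting the equations of motion into the polar form cancels the pairing of N with ∂ₜφ. What
remains are sums of the shape ⟨u, div F⟩ + ⟨grad u, F⟩, with u = ∂ₜw, F = N, and u = ∂ₜφᵢ, F = Mᵢ.
Green's formula `green` turns each of them into a boundary integral (`energyPairing_eq_boundary`).
The ports are differentiable because the trace is continuous and linear on H¹.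

The analytic weight lies in Green's formula for a Lipschitz domain whose boundary carries Hausdorff
measure and whose normal is defined by cones. Locally it rests on three facts: the arc length of a
Lipschitz graph is the integral of √(1 + g'²) (`hausdorffMeasure_graphMap_image`); the divergence
theorem holds below such a graph (`setIntegral_subgraph_fderiv`); the cone normal is the graph
normal wherever g is differentiable, hence almost everywhere by Rademacher. A partition of unity
makes this global. The divergence theorem for ζ f² in a direction transversal to the boundary also
gives the trace inequality, hence a continuous trace operator, and density of smooth functions
carries Green's formula to H¹. -/

/-- The parametrization `r ↦ (r, g r)` of the graph of `g`. -/
def graphMap (g : ℝ → ℝ) (r : ℝ) : Plane := !₂[r, g r]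

@[simp] theorem graphMap_zero (g : ℝ → ℝ) (r : ℝ) : graphMap g r 0 = r := rfl

@[simp] theorem graphMap_one (g : ℝ → ℝ) (r : ℝ) : graphMap g r 1 = g r := rfl

theorem continuous_graphMap {g : ℝ → ℝ} (hg : Continuous g) : Continuous (graphMap g) := by
  refine (PiLp.continuous_toLp 2 _).comp (continuous_pi fun i => ?_)
  fin_cases i
  · exact continuous_id
  · exact hg

theorem isClosedEmbedding_graphMap {g : ℝ → ℝ} (hg : Continuous g) :
    Topology.IsClosedEmbedding (graphMap g) := by
  have h0 : Continuous fun y : Plane => y 0 := by fun_prop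
  exact (Function.LeftInverse.isClosedEmbedding (f := fun y : Plane => y 0)
    (fun r => rfl) h0 (continuous_graphMap hg))

theorem plane_norm_eq (y : Plane) : ‖y‖ = √(y 0 ^ 2 + y 1 ^ 2) := by
  rw [EuclideanSpace.norm_eq, Fin.sum_univ_two]
  simp

/-- Reverse triangle inequality for the vectors (1, a) and (1, b). -/
theorem sqrt_one_add_sq_sub_le (a b : ℝ) : |√(1 + a ^ 2) - √(1 + b ^ 2)| ≤ |a - b| := by
  have h1 := plane_norm_eq !₂[1, a]
  have h2 := plane_norm_eq !₂[1, b]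
  have h3 := plane_norm_eq (!₂[1, a] - !₂[1, b])
  have h := abs_norm_sub_norm_le (!₂[1, a] : Plane) !₂[1, b]
  rw [h1, h2, h3] at h
  simpa [Real.sqrt_sq_eq_abs] using h

/-- The chord of the graph differs from (x - y, a(x - y)), a vector of length √(1 + a²)|x - y|, only
in its second coordinate. -/
theorem abs_dist_graphMap_sub_le {g : ℝ → ℝ} {a δ x y : ℝ}
    (h : |g x - g y - a * (x - y)| ≤ δ * |x - y|) :
    |dist (graphMap g x) (graphMap g y) - √(1 + a ^ 2) * (|x - y|)| ≤
      δ * |x - y| := by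
  have e1 : √(1 + a ^ 2) * |x - y| = ‖(!₂[x - y, a * (x - y)] : Plane)‖ := by
    rw [plane_norm_eq]
    simp only [Matrix.cons_val_zero, Matrix.cons_val_one]
    rw [← Real.sqrt_sq_eq_abs, ← Real.sqrt_mul (by positivity)]
    congr 1
    ring
  have e2 := plane_norm_eq (graphMap g x - graphMap g y - !₂[x - y, a * (x - y)])
  have h' := abs_norm_sub_norm_le (graphMap g x - graphMap g y) !₂[x - y, a * (x - y)]
  rw [dist_eq_norm, e1]
  refine h'.trans ?_
  rw [e2]
  simpa [Real.sqrt_sq_eq_abs] using h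

theorem hausdorffMeasure_graphMap_image_le {g : ℝ → ℝ} {s : Set ℝ} {c : ℝ≥0}
    (h : ∀ x ∈ s, ∀ y ∈ s, dist (graphMap g x) (graphMap g y) ≤ c * |x - y|) :
    μH[1] (graphMap g '' s) ≤ c * volume s := by
  have hl : LipschitzOnWith c (graphMap g) s :=
    LipschitzOnWith.of_dist_le_mul fun x hx y hy => h x hx y hy
  have := hl.hausdorffMeasure_image_le (d := 1) zero_le_one
  rwa [hausdorffMeasure_real, ENNReal.rpow_one] at this

/-- The projection to the first coordinate inverts the graph map and is Lipschitz with constant 1/c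
on the image. -/
theorem mul_volume_le_hausdorffMeasure_graphMap_image {g : ℝ → ℝ} {s : Set ℝ} {c : ℝ≥0}
    (h : ∀ x ∈ s, ∀ y ∈ s, c * |x - y| ≤ dist (graphMap g x) (graphMap g y)) :
    c * volume s ≤ μH[1] (graphMap g '' s) := by
  rcases eq_or_ne c 0 with rfl | hc
  · simp
  have hl : LipschitzOnWith c⁻¹ (fun y : Plane => y 0) (graphMap g '' s) := by
    refine LipschitzOnWith.of_dist_le_mul ?_
    rintro _ ⟨x, hx, rfl⟩ _ ⟨y, hy, rfl⟩
    have hc' : (0 : ℝ) < c := by positivity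
    rw [NNReal.coe_inv, inv_mul_eq_div, le_div_iff₀ hc', mul_comm]
    exact h x hx y hy
  have := hl.hausdorffMeasure_image_le (d := 1) zero_le_one
  rw [hausdorffMeasure_real, ENNReal.rpow_one, image_image] at this
  simp only [graphMap_zero, image_id'] at this
  calc (c : ℝ≥0∞) * volume s ≤ c * (((c⁻¹ : ℝ≥0) : ℝ≥0∞) * μH[1] (graphMap g '' s)) := by gcongr
    _ = μH[1] (graphMap g '' s) := by
      rw [← mul_assoc, ← ENNReal.coe_mul, mul_inv_cancel₀ hc, ENNReal.coe_one, one_mul]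

/-- The line element `√(1 + g'²)` of the graph of `g`. -/
noncomputable def lineElement (g : ℝ → ℝ) (r : ℝ) : ℝ := √(1 + deriv g r ^ 2)

theorem measurable_lineElement (g : ℝ → ℝ) : Measurable (lineElement g) :=
  ((measurable_deriv g).pow_const 2 |>.const_add 1).sqrt

theorem one_le_lineElement (g : ℝ → ℝ) (r : ℝ) : 1 ≤ lineElement g r := by
  rw [lineElement, Real.one_le_sqrt]
  nlinarith [sq_nonneg (deriv g r)]

theorem le_of_forall_one_lt_ennreal_le_mul {a b : ℝ≥0∞}
    (h : ∀ c : ℝ≥0, 1 < c → a ≤ c * b) : a ≤ b := by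
  have ht : Tendsto (fun c : ℝ≥0 => (c : ℝ≥0∞) * b) (𝓝[>] 1) (𝓝 (((1 : ℝ≥0) : ℝ≥0∞) * b)) := by
    refine ENNReal.Tendsto.mul_const ?_ (Or.inl (by simp))
    exact (ENNReal.continuous_coe.tendsto 1).mono_left nhdsWithin_le_nhds
  rw [ENNReal.coe_one, one_mul] at ht
  exact ge_of_tendsto ht (eventually_mem_nhdsWithin.mono fun c hc => h c hc)

/-- On a piece where `g` is nearly affine, the length of the graph and the integral of the line
element are comparable, with constants close to one. -/
theorem hausdorffMeasure_graphMap_image_compare {g : ℝ → ℝ} {s : Set ℝ} {a : ℝ} {δ : ℝ}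
    (hδ0 : 0 < δ) (hδ1 : δ < 1)
    (h : ∀ x ∈ s, ∀ y ∈ s, |g x - g y - a * (x - y)| ≤ δ * |x - y|)
    (hd : ∀ᵐ x ∂volume.restrict s, |deriv g x - a| ≤ δ) (c : ℝ≥0) (hc : (1 + δ) / (1 - δ) ≤ c) :
    μH[1] (graphMap g '' s) ≤ c * ∫⁻ x in s, ENNReal.ofReal (lineElement g x) ∧
    ∫⁻ x in s, ENNReal.ofReal (lineElement g x) ≤ c * μH[1] (graphMap g '' s) := by
  -- Both quantities lie between L(1 - δ)|s| and L(1 + δ)|s|. Since L ≥ 1, the additive error δ is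
  -- at most Lδ; the ratio of the two bounds no longer involves L.
  set L : ℝ := √(1 + a ^ 2) with hL
  have hL1 : 1 ≤ L := by
    rw [hL, Real.one_le_sqrt]
    nlinarith [sq_nonneg a]
  have hlo : 0 < L * (1 - δ) := mul_pos (by linarith) (by linarith)
  have hhi : 0 < L * (1 + δ) := mul_pos (by linarith) (by linarith)
  set lo : ℝ≥0 := ⟨L * (1 - δ), hlo.le⟩
  set hi : ℝ≥0 := ⟨L * (1 + δ), hhi.le⟩
  have hhl : hi ≤ c * lo := by
    rw [← NNReal.coe_le_coe, NNReal.coe_mul]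
    change L * (1 + δ) ≤ c * (L * (1 - δ))
    rw [div_le_iff₀ (by linarith)] at hc
    nlinarith
  have hhl' : (hi : ℝ≥0∞) ≤ c * lo := by exact_mod_cast hhl
  have A1 : μH[1] (graphMap g '' s) ≤ hi * volume s := by
    refine hausdorffMeasure_graphMap_image_le fun x hx y hy => ?_
    have := (abs_le.1 (abs_dist_graphMap_sub_le (h x hx y hy))).2
    change _ ≤ L * (1 + δ) * |x - y|
    nlinarith [abs_nonneg (x - y), mul_nonneg hδ0.le (abs_nonneg (x - y))]
  have A2 : lo * volume s ≤ μH[1] (graphMap g '' s) := by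
    refine mul_volume_le_hausdorffMeasure_graphMap_image fun x hx y hy => ?_
    have := (abs_le.1 (abs_dist_graphMap_sub_le (h x hx y hy))).1
    change L * (1 - δ) * |x - y| ≤ _
    nlinarith [abs_nonneg (x - y), mul_nonneg hδ0.le (abs_nonneg (x - y))]
  have hb : ∀ᵐ x ∂volume.restrict s, L * (1 - δ) ≤ lineElement g x ∧
      lineElement g x ≤ L * (1 + δ) := by
    filter_upwards [hd] with x hx
    have h1 := abs_le.1 ((sqrt_one_add_sq_sub_le (deriv g x) a).trans hx)
    rw [lineElement]
    constructor <;> nlinarith [h1.1, h1.2]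
  have B1 : ∫⁻ x in s, ENNReal.ofReal (lineElement g x) ≤ hi * volume s := by
    rw [← setLIntegral_const]
    refine lintegral_mono_ae (hb.mono fun x hx => ?_)
    rw [← ENNReal.ofReal_coe_nnreal]
    exact ENNReal.ofReal_le_ofReal hx.2
  have B2 : lo * volume s ≤ ∫⁻ x in s, ENNReal.ofReal (lineElement g x) := by
    rw [← setLIntegral_const]
    refine lintegral_mono_ae (hb.mono fun x hx => ?_)
    rw [← ENNReal.ofReal_coe_nnreal]
    exact ENNReal.ofReal_le_ofReal hx.1
  have key : (hi : ℝ≥0∞) * volume s ≤ c * (lo * volume s) := by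
    rw [← mul_assoc]
    gcongr
  exact ⟨A1.trans (key.trans (by gcongr)), B1.trans (key.trans (by gcongr))⟩

/-- The length of the graph of a Lipschitz function over a measurable set. -/
theorem hausdorffMeasure_graphMap_image {g : ℝ → ℝ} {K : ℝ≥0} (hg : LipschitzWith K g)
    {s : Set ℝ} (hs : MeasurableSet s) :
    μH[1] (graphMap g '' s) = ∫⁻ x in s, ENNReal.ofReal (lineElement g x) := by
  have hemb := (isClosedEmbedding_graphMap hg.continuous).measurableEmbedding
  set ν : Measure ℝ := (μH[1] : Measure Plane).comap (graphMap g) with hν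
  have hν_apply : ∀ s, ν s = μH[1] (graphMap g '' s) := fun s => hemb.comap_apply _ s
  set l : Measure ℝ := volume.withDensity fun x => ENNReal.ofReal (lineElement g x) with hl
  have hl_apply : ∀ s, MeasurableSet s → l s = ∫⁻ x in s, ENNReal.ofReal (lineElement g x) :=
    fun s hs => withDensity_apply _ hs
  -- Absolute continuity allows the null set where g is not differentiable to be discarded. The
  -- crude constant 1 + K comes from comparing g with slope zero.
  have hνac : ν ≪ volume := by
    refine Measure.AbsolutelyContinuous.mk fun s _ h0 => ?_
    rw [hν_apply, ← nonpos_iff_eq_zero]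
    refine (hausdorffMeasure_graphMap_image_le (c := 1 + K) fun x _ y _ => ?_).trans
      (by rw [h0, mul_zero])
    have h1 : |g x - g y - 0 * (x - y)| ≤ K * |x - y| := by
      have := hg.dist_le_mul x y
      rwa [Real.dist_eq, Real.dist_eq, ← sub_zero (g x - g y), ← zero_mul (x - y)] at this
    have := (abs_le.1 (abs_dist_graphMap_sub_le h1)).2
    simp only [ne_eq, OfNat.ofNat_ne_zero, not_false_eq_true, zero_pow, add_zero,
      Real.sqrt_one] at this
    push_cast
    linarith
  have hlac : l ≪ volume := withDensity_absolutelyContinuous _ _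
  set d : Set ℝ := {x | DifferentiableAt ℝ g x} with hd
  have hdm : MeasurableSet d := measurableSet_of_differentiableAt ℝ g
  have hd0 : volume dᶜ = 0 := by
    have := hg.ae_differentiableAt_real
    rwa [ae_iff] at this
  -- It suffices to compare the two measures up to every factor c > 1. The choice δ = (c - 1)/(c +
  -- 1) solves (1 + δ)/(1 - δ) = c.
  have key : ∀ c : ℝ≥0, 1 < c → ν s ≤ c * l s ∧ l s ≤ c * ν s := by
    intro c hc
    obtain ⟨δ, hδ0, hδ1, hδc⟩ : ∃ δ : ℝ, 0 < δ ∧ δ < 1 ∧ (1 + δ) / (1 - δ) ≤ c := by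
      have hc' : (1 : ℝ) < c := by exact_mod_cast hc
      refine ⟨(c - 1) / (c + 1), by apply div_pos <;> linarith, ?_, ?_⟩
      · rw [div_lt_one (by linarith)]
        linarith
      · rw [div_le_iff₀]
        · have : (c : ℝ) + 1 ≠ 0 := by linarith
          field_simp
          ring_nf
          exact le_refl _
        · rw [sub_pos, div_lt_one (by linarith)]
          linarith
    lift δ to ℝ≥0 using hδ0.le
    -- Countably many measurable pieces on each of which g is δ-close to one linear map; the
    -- derivative is then δ-close to that map almost everywhere on the piece.
    obtain ⟨t, A, htd, htm, hst, happ, -⟩ :=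
      exists_partition_approximatesLinearOn_of_hasFDerivWithinAt g (s ∩ d)
        (fun x => fderiv ℝ g x)
        (fun x hx => (DifferentiableAt.hasFDerivAt hx.2).hasFDerivWithinAt)
        (fun _ => δ) (fun _ => by exact_mod_cast hδ0.ne')
    have hpm : ∀ n, MeasurableSet (s ∩ d ∩ t n) := fun n => (hs.inter hdm).inter (htm n)
    have hpd : Pairwise (Function.onFun Disjoint fun n => s ∩ d ∩ t n) := fun i j hij =>
      (htd hij).mono inter_subset_right inter_subset_right
    have hunion : s ∩ d = ⋃ n, s ∩ d ∩ t n := by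
      rw [← inter_iUnion]
      exact (inter_eq_left.2 hst).symm
    have hdecomp : ∀ m : Measure ℝ, m ≪ volume → m s = ∑' n, m (s ∩ d ∩ t n) := by
      intro m hm
      rw [← measure_iUnion hpd hpm, ← hunion]
      refine le_antisymm ?_ (measure_mono inter_subset_left)
      calc m s ≤ m (s ∩ d ∪ dᶜ) := measure_mono fun x hx => by
            by_cases h : x ∈ d
            · exact Or.inl ⟨hx, h⟩
            · exact Or.inr h
        _ ≤ m (s ∩ d) + m dᶜ := measure_union_le _ _
        _ = m (s ∩ d) := by rw [hm hd0, add_zero]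
    have hpiece : ∀ n, ν (s ∩ d ∩ t n) ≤ c * l (s ∩ d ∩ t n) ∧
        l (s ∩ d ∩ t n) ≤ c * ν (s ∩ d ∩ t n) := by
      intro n
      rw [hν_apply, hl_apply _ (hpm n)]
      refine hausdorffMeasure_graphMap_image_compare (a := A n 1) hδ0 hδ1 ?_ ?_ c hδc
      · intro x hx y hy
        have := happ n x hx y hy
        rw [show A n (x - y) = A n 1 * (x - y) by
          rw [mul_comm, ← smul_eq_mul, ← map_smul, smul_eq_mul, mul_one]] at this
        exact this
      · have := (happ n).norm_fderiv_sub_le volume (hpm n) (fun x => fderiv ℝ g x)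
          (fun x hx => (DifferentiableAt.hasFDerivAt hx.1.2).hasFDerivWithinAt)
        refine this.mono fun x hx => ?_
        have h1 : ‖fderiv ℝ g x - A n‖ ≤ δ := hx
        have h2 := (fderiv ℝ g x - A n).le_opNorm 1
        rw [norm_one, mul_one] at h2
        exact h2.trans h1
    rw [hdecomp ν hνac, hdecomp l hlac, ← ENNReal.tsum_mul_left, ← ENNReal.tsum_mul_left]
    exact ⟨ENNReal.tsum_le_tsum fun n => (hpiece n).1, ENNReal.tsum_le_tsum fun n => (hpiece n).2⟩
  rw [← hν_apply, ← hl_apply s hs]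
  exact le_antisymm (le_of_forall_one_lt_ennreal_le_mul fun c hc => (key c hc).1)
    (le_of_forall_one_lt_ennreal_le_mul fun c hc => (key c hc).2)

/-! ### The divergence theorem below a Lipschitz graph -/

/-- The shear `(r, σ) ↦ (r, g r + σ)`. -/
def graphShear (g : ℝ → ℝ) (p : ℝ × ℝ) : Plane := graphMap (fun r => g r + p.2) p.1

theorem isClosedEmbedding_graphShear {g : ℝ → ℝ} (hg : Continuous g) :
    Topology.IsClosedEmbedding (graphShear g) := by
  refine Function.LeftInverse.isClosedEmbedding
    (f := fun y : Plane => (y 0, y 1 - g (y 0))) (fun p => ?_) (by fun_prop) ?_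
  · simp [graphShear]
  · refine (PiLp.continuous_toLp 2 _).comp (continuous_pi fun i => ?_)
    fin_cases i
    · exact continuous_fst
    · exact (hg.comp continuous_fst).add continuous_snd

/-- A skew product: each vertical line is only translated. -/
theorem measurePreserving_graphShear {g : ℝ → ℝ} (hg : Continuous g) :
    MeasurePreserving (graphShear g) := by
  have h1 : MeasurePreserving (fun p : ℝ × ℝ => (p.1, g p.1 + p.2)) :=
    (MeasurePreserving.id (volume : Measure ℝ)).skew_product
      (g := fun r σ => g r + σ) (by fun_prop)
      (Eventually.of_forall fun r => (measurePreserving_add_left volume (g r)).map_eq)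
  have h2 := (PiLp.volume_preserving_toLp (Fin 2)).comp
    ((volume_preserving_finTwoArrow ℝ).symm.comp h1)
  exact h2

theorem prod_restrict_Iio (a : ℝ) : (volume : Measure ℝ).prod (volume.restrict (Iio a)) =
    volume.restrict (univ ×ˢ Iio a) := by
  rw [Measure.volume_eq_prod, ← Measure.prod_restrict, Measure.restrict_univ]

theorem setIntegral_subgraph {g : ℝ → ℝ} (hg : Continuous g) (ψ : Plane → ℝ) :
    ∫ y in {y : Plane | y 1 < g (y 0)}, ψ y =
      ∫ p, ψ (graphShear g p) ∂(volume.prod (volume.restrict (Iio (0 : ℝ)))) := by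
  rw [← (measurePreserving_graphShear hg).setIntegral_preimage_emb
    (isClosedEmbedding_graphShear hg).measurableEmbedding]
  have h : graphShear g ⁻¹' {y : Plane | y 1 < g (y 0)} = univ ×ˢ Iio (0 : ℝ) := by
    ext p
    simp [graphShear]
  rw [h, prod_restrict_Iio]

theorem hasDerivAt_graphMap {g : ℝ → ℝ} {r : ℝ} (hg : DifferentiableAt ℝ g r) :
    HasDerivAt (graphMap g) !₂[1, deriv g r] r := by
  have h : HasDerivAt (fun r => ![r, g r]) ![1, deriv g r] r := by
    rw [hasDerivAt_pi]
    intro i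
    fin_cases i
    · exact hasDerivAt_id r
    · exact hg.hasDerivAt
  exact (PiLp.continuousLinearEquiv 2 ℝ (fun _ : Fin 2 => ℝ)).symm.toContinuousLinearMap
    |>.hasFDerivAt.comp_hasDerivAt r h

theorem lipschitzWith_graphMap {g : ℝ → ℝ} {K : ℝ≥0} (hg : LipschitzWith K g) :
    LipschitzWith (1 + K) (graphMap g) := by
  refine LipschitzWith.of_dist_le_mul fun x y => ?_
  have h1 : |g x - g y - 0 * (x - y)| ≤ K * |x - y| := by
    simpa [Real.dist_eq] using hg.dist_le_mul x y
  have := (abs_le.1 (abs_dist_graphMap_sub_le h1)).2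
  simp only [ne_eq, OfNat.ofNat_ne_zero, not_false_eq_true, zero_pow, add_zero,
    Real.sqrt_one] at this
  rw [Real.dist_eq x y]
  push_cast
  linarith

/-- Integration by parts against the constant 1. The direction is -1 because the formula reverses it
when it passes to the other factor. -/
theorem integral_deriv_eq_zero_of_lipschitzWith {f : ℝ → ℝ} {C : ℝ≥0} (hf : LipschitzWith C f)
    (hc : HasCompactSupport f) : ∫ x, deriv f x = 0 := by
  have h := LipschitzWith.integral_lineDeriv_mul_eq (μ := (volume : Measure ℝ))
    (LipschitzWith.const (1 : ℝ)) hf hc (-1)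
  have h1 : ∀ x, lineDeriv ℝ (fun _ : ℝ => (1 : ℝ)) x (-1) = 0 := fun x => by simp [lineDeriv]
  have h2 : ∀ x, lineDeriv ℝ f x 1 = deriv f x := fun x => by
    simp [lineDeriv, deriv_comp_const_add]
  simp only [h1, zero_mul, integral_zero, neg_neg, mul_one, h2] at h
  exact h.symm

/-- The divergence theorem for a compactly supported function on the region below the graph of a
Lipschitz function. -/
theorem setIntegral_subgraph_fderiv {g : ℝ → ℝ} {K : ℝ≥0} (hg : LipschitzWith K g)
    {F : Plane → ℝ} (hF : ContDiff ℝ 1 F) (hc : HasCompactSupport F) (v : Plane) :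
    ∫ y in {y : Plane | y 1 < g (y 0)}, fderiv ℝ F y v =
      ∫ r, F (graphMap g r) * (v 1 - deriv g r * v 0) := by
  have hT := isClosedEmbedding_graphShear hg.continuous
  set e : Plane := EuclideanSpace.single 1 1 with he
  have hF' : ∀ u : Plane, Continuous fun y => fderiv ℝ F y u := fun u =>
    (hF.continuous_fderiv one_ne_zero).clm_apply continuous_const
  have hc' : ∀ u : Plane, HasCompactSupport fun y => fderiv ℝ F y u := fun u =>
    hc.fderiv_apply ℝ u
  have hmono : (volume : Measure ℝ).prod (volume.restrict (Iio (0 : ℝ))) ≤ volume := by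
    rw [prod_restrict_Iio]
    exact Measure.restrict_le_self
  have hint : ∀ u : Plane, Integrable (fun p => fderiv ℝ F (graphShear g p) u)
      ((volume : Measure ℝ).prod (volume.restrict (Iio (0 : ℝ)))) := fun u =>
    (((hF' u).comp hT.continuous).integrable_of_hasCompactSupport
      ((hc' u).comp_isClosedEmbedding hT)).mono_measure hmono
  have hgm : Measurable fun p : ℝ × ℝ => deriv g p.1 := (measurable_deriv g).comp measurable_fst
  have hint' : ∀ u : Plane, Integrable (fun p : ℝ × ℝ =>
      deriv g p.1 * fderiv ℝ F (graphShear g p) u)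
      ((volume : Measure ℝ).prod (volume.restrict (Iio (0 : ℝ)))) := fun u =>
    (hint u).bdd_mul (c := K) hgm.aestronglyMeasurable
      (Eventually.of_forall fun p => norm_deriv_le_of_lipschitz hg)
  set e0 : Plane := EuclideanSpace.single 0 1 with he0
  have hv : v = v 0 • e0 + v 1 • e := by
    ext i
    fin_cases i <;> simp [he, he0]
  -- Split v into a multiple of (1, g'), tangent to the vertically translated graphs, and a vertical
  -- remainder.
  have hsplit : ∀ p, fderiv ℝ F (graphShear g p) v =
      v 0 * (fderiv ℝ F (graphShear g p) e0 + deriv g p.1 * fderiv ℝ F (graphShear g p) e) +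
      (v 1 - deriv g p.1 * v 0) * fderiv ℝ F (graphShear g p) e := by
    intro p
    conv_lhs => rw [hv]
    rw [map_add, map_smul, map_smul, smul_eq_mul, smul_eq_mul]
    ring
  -- The tangential part is, on every translated graph, the derivative of a compactly supported
  -- Lipschitz function of r, so it integrates to zero.
  have hA : ∫ p, (fderiv ℝ F (graphShear g p) e0 +
      deriv g p.1 * fderiv ℝ F (graphShear g p) e)
      ∂((volume : Measure ℝ).prod (volume.restrict (Iio (0 : ℝ)))) = 0 := by
    rw [integral_prod_symm]
    swap
    · exact (hint e0).add (hint' e)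
    refine integral_eq_zero_of_ae (Eventually.of_forall fun σ => ?_)
    have hgσ : LipschitzWith K fun r => g r + σ := by
      refine LipschitzWith.of_dist_le_mul fun x y => ?_
      rw [dist_add_right]
      exact hg.dist_le_mul x y
    obtain ⟨C, hC⟩ := ContDiff.lipschitzWith_of_hasCompactSupport hc hF one_ne_zero
    have h0 := integral_deriv_eq_zero_of_lipschitzWith (hC.comp (lipschitzWith_graphMap hgσ))
      (hc.comp_isClosedEmbedding (isClosedEmbedding_graphMap hgσ.continuous))
    simp only [Pi.zero_apply]
    rw [← h0]
    refine integral_congr_ae ?_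
    filter_upwards [hg.ae_differentiableAt_real] with r hr
    have hd := (hF.differentiable one_ne_zero
      (graphMap (fun r => g r + σ) r)).hasFDerivAt.comp_hasDerivAt r
      (hasDerivAt_graphMap (hr.add_const σ))
    rw [hd.deriv, deriv_add_const]
    have hu : (!₂[1, deriv g r] : Plane) = e0 + deriv g r • e := by
      ext i
      fin_cases i <;> simp [he, he0]
    rw [hu, map_add, map_smul, smul_eq_mul]
    rfl
  -- The vertical part is integrated by the fundamental theorem of calculus on half-lines ending at
  -- the graph. Its coefficient depends on r alone.
  have hB : ∫ p, (v 1 - deriv g p.1 * v 0) * fderiv ℝ F (graphShear g p) e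
      ∂((volume : Measure ℝ).prod (volume.restrict (Iio (0 : ℝ)))) =
      ∫ r, F (graphMap g r) * (v 1 - deriv g r * v 0) := by
    rw [integral_prod]
    · refine integral_congr_ae (Eventually.of_forall fun r => ?_)
      simp only
      rw [integral_const_mul, mul_comm]
      congr 1
      have hline : Topology.IsClosedEmbedding fun σ : ℝ => graphShear g (r, σ) :=
        hT.comp (Function.LeftInverse.isClosedEmbedding (f := Prod.snd) (fun _ => rfl)
          continuous_snd (by fun_prop))
      have hder : ∀ σ : ℝ, HasDerivAt (fun σ : ℝ => graphShear g (r, σ)) e σ := by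
        intro σ
        have h : HasDerivAt (fun σ : ℝ => graphMap g r + σ • e) ((1 : ℝ) • e) σ :=
          ((hasDerivAt_id σ).smul_const e).const_add _
        rw [one_smul] at h
        refine h.congr_of_eventuallyEq (Eventually.of_forall fun s => ?_)
        ext i
        fin_cases i <;> simp [graphShear, he]
      have hcd : ContDiff ℝ 1 fun σ : ℝ => F (graphShear g (r, σ)) := by
        refine hF.comp ?_
        have h : (fun σ : ℝ => graphShear g (r, σ)) = fun σ => graphMap g r + σ • e := by
          funext s
          ext i
          fin_cases i <;> simp [graphShear, he]
        rw [h]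
        fun_prop
      have h := HasCompactSupport.integral_Iic_deriv_eq hcd (hc.comp_isClosedEmbedding hline) 0
      rw [integral_Iic_eq_integral_Iio] at h
      have h0 : graphShear g (r, 0) = graphMap g r := by simp [graphShear]
      rw [h0] at h
      rw [← h]
      refine integral_congr_ae (Eventually.of_forall fun σ => ?_)
      exact (((hF.differentiable one_ne_zero _).hasFDerivAt.comp_hasDerivAt σ
        (hder σ)).deriv).symm
    · have := ((hint e).const_mul (v 1)).sub ((hint' e).mul_const (v 0))
      refine this.congr (Eventually.of_forall fun p => ?_)
      simp only [Pi.sub_apply]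
      ring
  rw [setIntegral_subgraph hg.continuous]
  simp only [hsplit]
  rw [integral_add, integral_const_mul, hA, hB, mul_zero, zero_add]
  · exact ((hint e0).add (hint' e)).const_mul _
  · have := ((hint e).const_mul (v 1)).sub ((hint' e).mul_const (v 0))
    refine this.congr (Eventually.of_forall fun p => ?_)
    simp only [Pi.sub_apply]
    ring

/-! ### The outward normal -/

/-- Leave x in the direction ν' - ν. Its inner products with ν and ν' are -c and c, where c = 1 -
⟨ν, ν'⟩ > 0 if the vectors differ, so the first normal puts nearby points inside Ω and the second
puts them outside. The aperture ε corresponds to c/2, which makes both cone inequalities strict. -/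
theorem IsOutwardUnitNormal.unique {Ω : Set Plane} {x ν ν' : Plane}
    (h : IsOutwardUnitNormal Ω x ν) (h' : IsOutwardUnitNormal Ω x ν') : ν = ν' := by
  by_contra hne
  set c : ℝ := 1 - inner ℝ ν ν' with hc
  have hu0 : 0 < ‖ν' - ν‖ := norm_pos_iff.2 (sub_ne_zero.2 (Ne.symm hne))
  have hc2 : 2 * c = ‖ν' - ν‖ ^ 2 := by
    rw [norm_sub_sq_real, h.1, h'.1, real_inner_comm, hc]
    ring
  have hcpos : 0 < c := by nlinarith
  have e1 : inner ℝ ν (ν' - ν) = -c := by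
    rw [inner_sub_right, real_inner_self_eq_norm_sq, h.1, hc]
    ring
  have e2 : inner ℝ ν' (ν' - ν) = c := by
    rw [inner_sub_right, real_inner_self_eq_norm_sq, h'.1, hc, real_inner_comm]
    ring
  set ε : ℝ := c / (2 * ‖ν' - ν‖) with hε
  have hεpos : 0 < ε := by positivity
  have hεu : ε * ‖ν' - ν‖ = c / 2 := by
    rw [hε]
    field_simp
  have hcurve : Tendsto (fun t : ℝ => x + t • (ν' - ν)) (𝓝[>] 0) (𝓝 x) := by
    have : Continuous fun t : ℝ => x + t • (ν' - ν) := by fun_prop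
    have h0 := this.tendsto 0
    rw [zero_smul, add_zero] at h0
    exact h0.mono_left nhdsWithin_le_nhds
  obtain ⟨t, ⟨h1, h2⟩, ht⟩ := ((hcurve.eventually ((h.2 ε hεpos).and (h'.2 ε hεpos))).and
    self_mem_nhdsWithin).exists
  have ht' : 0 < t := ht
  have hn : ε * ‖x + t • (ν' - ν) - x‖ = t * (c / 2) := by
    rw [add_sub_cancel_left, norm_smul, Real.norm_of_nonneg ht'.le, ← hεu]
    ring
  refine h2.2 ?_ (h1.1 ?_)
  · rw [hn, add_sub_cancel_left, inner_smul_right, e2]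
    nlinarith
  · rw [hn, add_sub_cancel_left, inner_smul_right, e1]
    nlinarith

theorem outwardNormal_eq {Ω : Set Plane} {x ν : Plane} (h : IsOutwardUnitNormal Ω x ν) :
    outwardNormal Ω x = ν := by
  have hx : ∃ ν, IsOutwardUnitNormal Ω x ν := ⟨ν, h⟩
  rw [outwardNormal, dif_pos hx]
  exact hx.choose_spec.unique h

theorem norm_outwardNormal_le (Ω : Set Plane) (x : Plane) : ‖outwardNormal Ω x‖ ≤ 1 := by
  rw [outwardNormal]
  split_ifs with hx
  · exact hx.choose_spec.1.le
  · simp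

/-! ### Graph charts of the boundary -/

/-- On the open set `U`, the set `Ω` is the region strictly below the graph of the Lipschitz
function `g`, in the frame given by `Φ`. -/
structure IsGraphChart (Ω : Set Plane) (Φ : Plane ≃ₗᵢ[ℝ] Plane) (K : ℝ≥0) (g : ℝ → ℝ)
    (U : Set Plane) : Prop where
  lipschitz : LipschitzWith K g
  isOpen : IsOpen U
  mem_iff : ∀ y ∈ U, (y ∈ Ω ↔ Φ y 1 < g (Φ y 0))

/-- The graph of `g`, in the frame given by `Φ`. -/
noncomputable def graphCurve (Φ : Plane ≃ₗᵢ[ℝ] Plane) (g : ℝ → ℝ) (r : ℝ) : Plane :=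
  Φ.symm (graphMap g r)

@[simp] theorem apply_graphCurve (Φ : Plane ≃ₗᵢ[ℝ] Plane) (g : ℝ → ℝ) (r : ℝ) :
    Φ (graphCurve Φ g r) = graphMap g r := Φ.apply_symm_apply _

theorem isClosedEmbedding_graphCurve (Φ : Plane ≃ₗᵢ[ℝ] Plane) {g : ℝ → ℝ} (hg : Continuous g) :
    Topology.IsClosedEmbedding (graphCurve Φ g) :=
  Φ.symm.toHomeomorph.isClosedEmbedding.comp (isClosedEmbedding_graphMap hg)

theorem graphCurve_eq_iff {Φ : Plane ≃ₗᵢ[ℝ] Plane} {g : ℝ → ℝ} {y : Plane} :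
    graphCurve Φ g (Φ y 0) = y ↔ Φ y 1 = g (Φ y 0) := by
  rw [graphCurve, LinearIsometryEquiv.symm_apply_eq]
  constructor
  · intro h
    rw [← h]
    simp
  · intro h
    ext i
    fin_cases i
    · simp
    · simp [h]

theorem plane_inner_eq (x y : Plane) : inner ℝ x y = x 0 * y 0 + x 1 * y 1 := by
  rw [PiLp.inner_apply, Fin.sum_univ_two]
  simp [mul_comm]

/-- The upward unit normal of the graph of `g`. -/
noncomputable def graphNormal (g : ℝ → ℝ) (r : ℝ) : Plane :=
  (lineElement g r)⁻¹ • !₂[-deriv g r, 1]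

theorem measurable_graphNormal (g : ℝ → ℝ) : Measurable (graphNormal g) := by
  refine (measurable_lineElement g).inv.smul ?_
  refine (WithLp.measurable_toLp 2 _).comp (measurable_pi_iff.2 fun i => ?_)
  fin_cases i
  · exact (measurable_deriv g).neg
  · exact measurable_const

theorem norm_graphNormal (g : ℝ → ℝ) (r : ℝ) : ‖graphNormal g r‖ = 1 := by
  have h := one_le_lineElement g r
  rw [graphNormal, norm_smul, plane_norm_eq, norm_inv, Real.norm_of_nonneg (by linarith)]
  simp only [Matrix.cons_val_zero, Matrix.cons_val_one, one_pow, neg_sq]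
  rw [add_comm, ← lineElement, inv_mul_cancel₀ (by linarith)]

theorem lineElement_le {g : ℝ → ℝ} {K : ℝ≥0} (hg : LipschitzWith K g) (r : ℝ) :
    lineElement g r ≤ 1 + K := by
  have h := abs_le.1 (norm_deriv_le_of_lipschitz hg (x₀ := r))
  rw [lineElement, Real.sqrt_le_left (by positivity)]
  nlinarith [h.1, h.2, K.2]

namespace IsGraphChart

variable {Ω : Set Plane} {Φ : Plane ≃ₗᵢ[ℝ] Plane} {K : ℝ≥0} {g : ℝ → ℝ} {U : Set Plane}

/-- Points strictly above the graph have a neighbourhood that misses Ω, and a point of the graph is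
a limit of points vertically below it. -/
theorem mem_frontier_iff (h : IsGraphChart Ω Φ K g U) (hΩ : IsOpen Ω) {y : Plane} (hy : y ∈ U) :
    y ∈ frontier Ω ↔ Φ y 1 = g (Φ y 0) := by
  have hUy : ∀ᶠ z in 𝓝 y, z ∈ U := h.isOpen.mem_nhds hy
  have hg : Continuous fun z : Plane => g (Φ z 0) := by
    have := h.lipschitz.continuous
    fun_prop
  have h1 : Continuous fun z : Plane => Φ z 1 := by fun_prop
  rw [hΩ.frontier_eq]
  constructor
  · rintro ⟨hcl, hnot⟩
    rw [h.mem_iff y hy, not_lt] at hnot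
    refine le_antisymm (not_lt.1 fun hlt => ?_) hnot
    have hev : ∀ᶠ z in 𝓝 y, z ∉ Ω := by
      filter_upwards [hUy, (hg.tendsto y).eventually_lt (h1.tendsto y) hlt] with z hz hz'
      rw [h.mem_iff z hz]
      exact hz'.not_gt
    exact (mem_closure_iff_frequently.1 hcl) hev
  · intro he
    refine ⟨?_, by rw [h.mem_iff y hy, he]; exact lt_irrefl _⟩
    have hcurve : Tendsto (fun t : ℝ => y - t • Φ.symm (EuclideanSpace.single 1 1))
        (𝓝[>] 0) (𝓝 y) := by
      have : Continuous fun t : ℝ => y - t • Φ.symm (EuclideanSpace.single 1 1) := by fun_prop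
      have h0 := this.tendsto 0
      rw [zero_smul, sub_zero] at h0
      exact h0.mono_left nhdsWithin_le_nhds
    refine mem_closure_of_tendsto hcurve ?_
    filter_upwards [hcurve.eventually hUy, self_mem_nhdsWithin] with t ht ht0
    have ht0' : 0 < t := ht0
    rw [h.mem_iff _ ht, map_sub, map_smul, Φ.apply_symm_apply]
    simp [he, ht0']

/-- In a chart the frontier is the range of `graphCurve`, and the isometry preserves Hausdorff
measure, so the arc length formula applies. -/
theorem boundaryMeasure_restrict (h : IsGraphChart Ω Φ K g U) (hΩ : IsOpen Ω) :
    (boundaryMeasure Ω).restrict U =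
      ((volume.withDensity fun r => ENNReal.ofReal (lineElement g r)).map
        (graphCurve Φ g)).restrict U := by
  have hemb := isClosedEmbedding_graphCurve Φ h.lipschitz.continuous
  ext A hA
  have hAU : MeasurableSet (A ∩ U) := hA.inter h.isOpen.measurableSet
  have hpre : MeasurableSet (graphCurve Φ g ⁻¹' (A ∩ U)) := hemb.continuous.measurable hAU
  rw [Measure.restrict_apply hA, Measure.restrict_apply hA, boundaryMeasure,
    Measure.restrict_apply hAU, Measure.map_apply hemb.continuous.measurable hAU,
    withDensity_apply _ hpre, ← hausdorffMeasure_graphMap_image h.lipschitz hpre,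
    ← Φ.symm.isometry.hausdorffMeasure_image (Or.inl zero_le_one)
      (graphMap g '' (graphCurve Φ g ⁻¹' (A ∩ U))), image_image]
  congr 1
  change _ = graphCurve Φ g '' (graphCurve Φ g ⁻¹' (A ∩ U))
  rw [image_preimage_eq_inter_range]
  ext y
  refine and_congr_right fun hy => ?_
  rw [h.mem_frontier_iff hΩ hy.2, ← graphCurve_eq_iff]
  constructor
  · exact fun h => ⟨_, h⟩
  · rintro ⟨r, rfl⟩
    simp

/-- For a displacement with frame coordinates (a, b), the inner product with the normal is (b - g'
a) divided by the line element. Differentiability keeps the graph within ε|a| of its tangent, and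
the line element, being at least 1, only enlarges the cone threshold. -/
theorem isOutwardUnitNormal (h : IsGraphChart Ω Φ K g U) {r : ℝ} (hr : graphCurve Φ g r ∈ U)
    (hd : DifferentiableAt ℝ g r) :
    IsOutwardUnitNormal Ω (graphCurve Φ g r) (Φ.symm (graphNormal g r)) := by
  refine ⟨by rw [LinearIsometryEquiv.norm_map, norm_graphNormal], fun ε hε => ?_⟩
  have hL := one_le_lineElement g r
  have hLpos : 0 < lineElement g r := by linarith
  have h0 : Tendsto (fun y : Plane => Φ y 0) (𝓝 (graphCurve Φ g r)) (𝓝 r) := by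
    have : Continuous fun y : Plane => Φ y 0 := by fun_prop
    have := this.tendsto (graphCurve Φ g r)
    simpa using this
  have ho := h0.eventually ((hasDerivAt_iff_isLittleO.1 hd.hasDerivAt).bound hε)
  filter_upwards [ho, h.isOpen.mem_nhds hr] with y hy hyU
  rw [h.mem_iff y hyU]
  set a : ℝ := Φ y 0 - r with ha
  set b : ℝ := Φ y 1 - g r with hb
  have hinner : inner ℝ (Φ.symm (graphNormal g r)) (y - graphCurve Φ g r) =
      (b - deriv g r * a) / lineElement g r := by
    rw [← Φ.symm_apply_apply (y - graphCurve Φ g r), LinearIsometryEquiv.inner_map_map, map_sub,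
      apply_graphCurve, plane_inner_eq, graphNormal]
    simp only [PiLp.smul_apply, PiLp.sub_apply, Matrix.cons_val_zero, Matrix.cons_val_one,
      smul_eq_mul, graphMap_zero, graphMap_one, ← ha, ← hb]
    field_simp
    ring
  have ha_le : |a| ≤ ‖y - graphCurve Φ g r‖ := by
    rw [← Φ.norm_map, map_sub, apply_graphCurve]
    have := PiLp.norm_apply_le (Φ y - graphMap g r) 0
    simpa [ha] using this
  have hy' := abs_le.1 (hy.trans (mul_le_mul_of_nonneg_left ha_le hε.le))
  rw [smul_eq_mul] at hy'
  have hmono : ε * ‖y - graphCurve Φ g r‖ ≤ ε * ‖y - graphCurve Φ g r‖ * lineElement g r :=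
    le_mul_of_one_le_right (by positivity) hL
  rw [hinner]
  constructor
  · intro hlt
    rw [div_lt_iff₀ hLpos] at hlt
    nlinarith [hy'.1]
  · intro hlt
    rw [lt_div_iff₀ hLpos] at hlt
    nlinarith [hy'.2]

theorem outwardNormal_graphCurve (h : IsGraphChart Ω Φ K g U) {r : ℝ}
    (hr : graphCurve Φ g r ∈ U) (hd : DifferentiableAt ℝ g r) :
    outwardNormal Ω (graphCurve Φ g r) = Φ.symm (graphNormal g r) :=
  outwardNormal_eq (h.isOutwardUnitNormal hr hd)

/-- By Rademacher g is differentiable for almost every r, and arc length has a density with respect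
to dr, so the exceptional boundary points form a null set. -/
theorem outwardNormal_ae_eq (h : IsGraphChart Ω Φ K g U) (hΩ : IsOpen Ω) :
    outwardNormal Ω =ᵐ[(boundaryMeasure Ω).restrict U]
      fun y => Φ.symm (graphNormal g (Φ y 0)) := by
  have hemb := isClosedEmbedding_graphCurve Φ h.lipschitz.continuous
  have h0 : Measurable fun y : Plane => Φ y 0 := by
    have : Continuous fun y : Plane => Φ y 0 := by fun_prop
    exact this.measurable
  have hd : ∀ᵐ y ∂(boundaryMeasure Ω).restrict U, DifferentiableAt ℝ g (Φ y 0) := by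
    rw [h.boundaryMeasure_restrict hΩ]
    refine ae_restrict_of_ae ?_
    rw [ae_map_iff (p := fun y => DifferentiableAt ℝ g (Φ y 0)) hemb.continuous.aemeasurable
      (h0 (measurableSet_of_differentiableAt ℝ g))]
    refine (withDensity_absolutelyContinuous _ _).ae_le ?_
    exact h.lipschitz.ae_differentiableAt_real.mono fun r hr => by simpa using hr
  have hf : ∀ᵐ y ∂(boundaryMeasure Ω).restrict U, y ∈ frontier Ω :=
    ae_restrict_of_ae (ae_restrict_mem isClosed_frontier.measurableSet)
  filter_upwards [hd, hf, ae_restrict_mem h.isOpen.measurableSet] with y hyd hyf hyU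
  have hy := graphCurve_eq_iff.2 ((h.mem_frontier_iff hΩ hyU).1 hyf)
  have := h.outwardNormal_graphCurve (r := Φ y 0) (by rwa [hy]) hyd
  rwa [hy] at this

theorem aestronglyMeasurable_outwardNormal (h : IsGraphChart Ω Φ K g U) (hΩ : IsOpen Ω) :
    AEStronglyMeasurable (outwardNormal Ω) ((boundaryMeasure Ω).restrict U) := by
  have h0 : Continuous fun y : Plane => Φ y 0 := by fun_prop
  refine AEStronglyMeasurable.congr ?_ (h.outwardNormal_ae_eq hΩ).symm
  exact (Φ.symm.continuous.measurable.comp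
    ((measurable_graphNormal g).comp h0.measurable)).aestronglyMeasurable

theorem integral_boundaryMeasure (h : IsGraphChart Ω Φ K g U) (hΩ : IsOpen Ω) {ψ : Plane → ℝ}
    (hψ : ∀ y ∉ U, ψ y = 0) :
    ∫ y, ψ y ∂boundaryMeasure Ω = ∫ r, lineElement g r * ψ (graphCurve Φ g r) := by
  have hemb := isClosedEmbedding_graphCurve Φ h.lipschitz.continuous
  rw [← setIntegral_eq_integral_of_forall_compl_eq_zero hψ, h.boundaryMeasure_restrict hΩ,
    setIntegral_eq_integral_of_forall_compl_eq_zero hψ, hemb.measurableEmbedding.integral_map,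
    integral_withDensity_eq_integral_toReal_smul (measurable_lineElement g).ennreal_ofReal
      (Eventually.of_forall fun r => ENNReal.ofReal_lt_top)]
  refine integral_congr_ae (Eventually.of_forall fun r => ?_)
  simp only [smul_eq_mul]
  rw [ENNReal.toReal_ofReal (zero_le_one.trans (one_le_lineElement g r))]

theorem boundaryMeasure_lt_top (h : IsGraphChart Ω Φ K g U) (hΩ : IsOpen Ω)
    (hU : Bornology.IsBounded U) : boundaryMeasure Ω U < ⊤ := by
  have hemb := isClosedEmbedding_graphCurve Φ h.lipschitz.continuous
  have hpre : MeasurableSet (graphCurve Φ g ⁻¹' U) :=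
    hemb.continuous.measurable h.isOpen.measurableSet
  rw [← Measure.restrict_apply_self, h.boundaryMeasure_restrict hΩ, Measure.restrict_apply_self,
    Measure.map_apply hemb.continuous.measurable h.isOpen.measurableSet, withDensity_apply _ hpre]
  obtain ⟨R, hR⟩ := hU.subset_closedBall 0
  have hsub : graphCurve Φ g ⁻¹' U ⊆ Metric.closedBall 0 R := by
    intro r hr
    have h1 := mem_closedBall_zero_iff.1 (hR hr)
    rw [← Φ.norm_map, apply_graphCurve] at h1
    exact mem_closedBall_zero_iff.2 ((PiLp.norm_apply_le (graphMap g r) 0).trans h1)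
  calc ∫⁻ r in graphCurve Φ g ⁻¹' U, ENNReal.ofReal (lineElement g r)
      ≤ ∫⁻ _ in graphCurve Φ g ⁻¹' U, ENNReal.ofReal (1 + K) :=
        lintegral_mono fun r => ENNReal.ofReal_le_ofReal (lineElement_le h.lipschitz r)
    _ = ENNReal.ofReal (1 + K) * volume (graphCurve Φ g ⁻¹' U) := setLIntegral_const _ _
    _ < ⊤ := ENNReal.mul_lt_top ENNReal.ofReal_lt_top
        ((measure_mono hsub).trans_lt measure_closedBall_lt_top)

/-- Ω and the full subgraph can differ only outside U, where the derivative of f vanishes; the frame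
change preserves volume. -/
theorem setIntegral_fderiv (h : IsGraphChart Ω Φ K g U) (hΩ : IsOpen Ω) {f : Plane → ℝ}
    (hf : ContDiff ℝ 1 f) (hc : HasCompactSupport f) (hU : tsupport f ⊆ U) (v : Plane) :
    ∫ y in Ω, fderiv ℝ f y v =
      ∫ r, f (graphCurve Φ g r) * (Φ v 1 - deriv g r * Φ v 0) := by
  have hg : Continuous fun z : Plane => g (z 0) := by
    have := h.lipschitz.continuous
    fun_prop
  have hS : IsOpen {z : Plane | z 1 < g (z 0)} := isOpen_lt (by fun_prop) hg
  have h1 := setIntegral_subgraph_fderiv h.lipschitz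
    (hf.comp Φ.symm.toContinuousLinearEquiv.contDiff)
    (hc.comp_homeomorph Φ.symm.toHomeomorph) (Φ v)
  have h2 : ∀ z, fderiv ℝ (f ∘ ⇑Φ.symm.toContinuousLinearEquiv) z (Φ v) =
      fderiv ℝ f (Φ.symm z) v := by
    intro z
    rw [ContinuousLinearEquiv.comp_right_fderiv]
    simp
  simp only [h2] at h1
  have h3 := Φ.symm.measurePreserving.setIntegral_preimage_emb
    Φ.symm.toHomeomorph.measurableEmbedding (fun y => fderiv ℝ f y v)
    {y | Φ y 1 < g (Φ y 0)}
  have h4 : ⇑Φ.symm ⁻¹' {y | Φ y 1 < g (Φ y 0)} = {z : Plane | z 1 < g (z 0)} := by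
    ext z
    simp
  rw [h4, h1] at h3
  refine Eq.trans ?_ h3.symm
  have hS' : MeasurableSet {y | Φ y 1 < g (Φ y 0)} :=
    (hS.preimage Φ.continuous).measurableSet
  rw [← integral_indicator hΩ.measurableSet, ← integral_indicator hS']
  refine integral_congr_ae (Eventually.of_forall fun y => ?_)
  by_cases hy : y ∈ U
  · have := h.mem_iff y hy
    simp only [indicator, mem_ofPred_eq, this]
  · have h0 : fderiv ℝ f y = 0 := image_eq_zero_of_notMem_tsupport
      fun h' => hy (hU (tsupport_fderiv_subset ℝ h'))
    simp [indicator, h0]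

/-- The divergence theorem for a function with compact support in a chart. -/
theorem setIntegral_fderiv_eq_boundary (h : IsGraphChart Ω Φ K g U) (hΩ : IsOpen Ω)
    {f : Plane → ℝ} (hf : ContDiff ℝ 1 f) (hc : HasCompactSupport f) (hU : tsupport f ⊆ U)
    (v : Plane) :
    ∫ y in Ω, fderiv ℝ f y v =
      ∫ y, f y * inner ℝ v (outwardNormal Ω y) ∂boundaryMeasure Ω := by
  have h0 : ∀ y ∉ U, f y = 0 := fun y hy =>
    image_eq_zero_of_notMem_tsupport fun h' => hy (hU h')
  rw [h.setIntegral_fderiv hΩ hf hc hU,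
    h.integral_boundaryMeasure hΩ fun y hy => by rw [h0 y hy, zero_mul]]
  refine integral_congr_ae ?_
  filter_upwards [h.lipschitz.ae_differentiableAt_real] with r hr
  by_cases hrU : graphCurve Φ g r ∈ U
  · have hL := one_le_lineElement g r
    have hL0 : lineElement g r ≠ 0 := by linarith
    -- The line element of arc length cancels the normalizing factor of the normal.
    rw [h.outwardNormal_graphCurve hrU hr, ← LinearIsometryEquiv.inner_map_eq_flip,
      plane_inner_eq, graphNormal]
    simp only [PiLp.smul_apply, Matrix.cons_val_zero, Matrix.cons_val_one, smul_eq_mul]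
    field_simp
    ring
  · rw [h0 _ hrU]
    ring

/-- The trace inequality for a nonnegative function with compact support in a chart. -/
theorem integral_boundary_le (h : IsGraphChart Ω Φ K g U) (hΩ : IsOpen Ω)
    {f : Plane → ℝ} (hf : ContDiff ℝ 1 f) (hc : HasCompactSupport f) (hU : tsupport f ⊆ U)
    (hpos : ∀ y, 0 ≤ f y) :
    ∫ y, f y ∂boundaryMeasure Ω ≤
      (1 + K) * ∫ y in Ω, fderiv ℝ f y (Φ.symm (EuclideanSpace.single 1 1)) := by
  have h0 : ∀ y ∉ U, f y = 0 := fun y hy =>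
    image_eq_zero_of_notMem_tsupport fun h' => hy (hU h')
  have hemb := isClosedEmbedding_graphCurve Φ h.lipschitz.continuous
  have hint : Integrable fun r => f (graphCurve Φ g r) :=
    (hf.continuous.comp hemb.continuous).integrable_of_hasCompactSupport
      (hc.comp_isClosedEmbedding hemb)
  -- In the frame the direction is (0, 1), so the volume integral is the integral of f over the
  -- graph against dr; passing to arc length costs at most 1 + K.
  rw [h.setIntegral_fderiv hΩ hf hc hU, h.integral_boundaryMeasure hΩ h0, ← integral_const_mul]
  refine integral_mono_of_nonneg (Eventually.of_forall fun r => ?_) ?_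
    (Eventually.of_forall fun r => ?_)
  · exact mul_nonneg (zero_le_one.trans (one_le_lineElement g r)) (hpos _)
  · simpa using hint.const_mul (1 + K : ℝ)
  · simpa using mul_le_mul_of_nonneg_right (lineElement_le h.lipschitz r) (hpos _)

end IsGraphChart

/-! ### Localization -/

theorem integral_fderiv_apply_eq_zero {f : Plane → ℝ} (hf : ContDiff ℝ 1 f)
    (hc : HasCompactSupport f) (v : Plane) : ∫ y, fderiv ℝ f y v = 0 := by
  obtain ⟨C, hC⟩ := ContDiff.lipschitzWith_of_hasCompactSupport hc hf one_ne_zero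
  have h := LipschitzWith.integral_lineDeriv_mul_eq (μ := (volume : Measure Plane))
    (LipschitzWith.const (1 : ℝ)) hC hc (-v)
  have h1 : ∀ x, lineDeriv ℝ (fun _ : Plane => (1 : ℝ)) x (-v) = 0 := fun x => by
    simp [lineDeriv]
  have h2 : ∀ x, lineDeriv ℝ f x v = fderiv ℝ f x v := fun x =>
    (hf.differentiable one_ne_zero x).lineDeriv_eq_fderiv
  simp only [h1, zero_mul, integral_zero, neg_neg, mul_one, h2] at h
  exact h.symm

/-- A bounded open set such that the divergence theorem and the trace inequality hold for
functions with compact support in it. -/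
structure IsPatch (Ω U : Set Plane) : Prop where
  isOpen : IsOpen U
  bounded : Bornology.IsBounded U
  boundaryMeasure_lt_top : boundaryMeasure Ω U < ⊤
  aestronglyMeasurable_normal :
    AEStronglyMeasurable (outwardNormal Ω) ((boundaryMeasure Ω).restrict U)
  divergence : ∀ f : Plane → ℝ, ContDiff ℝ 1 f → HasCompactSupport f → tsupport f ⊆ U →
    ∀ v, ∫ y in Ω, fderiv ℝ f y v = ∫ y, f y * inner ℝ v (outwardNormal Ω y) ∂boundaryMeasure Ω
  trace_le : ∃ C : ℝ, 0 ≤ C ∧ ∃ e : Plane, ∀ f : Plane → ℝ, ContDiff ℝ 1 f →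
    HasCompactSupport f → tsupport f ⊆ U → (∀ y, 0 ≤ f y) →
    ∫ y, f y ∂boundaryMeasure Ω ≤ C * ∫ y in Ω, fderiv ℝ f y e

/-- Interior points need no chart: an open set misses its frontier, so every boundary term is zero
and the trace constant can be 0. -/
theorem isPatch_self {Ω : Set Plane} (hΩ : IsOpen Ω) (hb : Bornology.IsBounded Ω) :
    IsPatch Ω Ω := by
  have hdisj : Ω ∩ frontier Ω = ∅ := hΩ.inter_frontier_eq
  have h0 : boundaryMeasure Ω Ω = 0 := by
    rw [boundaryMeasure, Measure.restrict_apply hΩ.measurableSet, hdisj, measure_empty]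
  have hae : ∀ f : Plane → ℝ, tsupport f ⊆ Ω → f =ᵐ[boundaryMeasure Ω] 0 := by
    intro f hf
    filter_upwards [ae_restrict_mem isClosed_frontier.measurableSet] with y hy
    refine image_eq_zero_of_notMem_tsupport fun h => ?_
    have : y ∈ Ω ∩ frontier Ω := ⟨hf h, hy⟩
    rwa [hdisj] at this
  refine ⟨hΩ, hb, by simp [h0], ?_, fun f hf hc hs v => ?_, 0, le_rfl, 0, fun f hf hc hs hp => ?_⟩
  · rw [Measure.restrict_zero_set h0]
    exact aestronglyMeasurable_zero_measure _
  · rw [setIntegral_eq_integral_of_forall_compl_eq_zero, integral_fderiv_apply_eq_zero hf hc,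
      integral_eq_zero_of_ae]
    · filter_upwards [hae f hs] with y hy
      simp [hy]
    · intro y hy
      have h0 : fderiv ℝ f y = 0 := image_eq_zero_of_notMem_tsupport
        fun h' => hy (hs (tsupport_fderiv_subset ℝ h'))
      simp [h0]
  · rw [integral_eq_zero_of_ae (hae f hs), zero_mul]

theorem IsGraphChart.isPatch {Ω : Set Plane} {Φ : Plane ≃ₗᵢ[ℝ] Plane} {K : ℝ≥0} {g : ℝ → ℝ}
    {U : Set Plane} (h : IsGraphChart Ω Φ K g U) (hΩ : IsOpen Ω) (hU : Bornology.IsBounded U) :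
    IsPatch Ω U where
  isOpen := h.isOpen
  bounded := hU
  boundaryMeasure_lt_top := h.boundaryMeasure_lt_top hΩ hU
  aestronglyMeasurable_normal := h.aestronglyMeasurable_outwardNormal hΩ
  divergence _ hf hc hs v := h.setIntegral_fderiv_eq_boundary hΩ hf hc hs v
  trace_le := ⟨1 + K, by positivity, _, fun _ hf hc hs hp => h.integral_boundary_le hΩ hf hc hs hp⟩

theorem exists_isPatch {Ω : Set Plane} (hΩ : IsOpen Ω) (hb : Bornology.IsBounded Ω)
    (hl : HasLipschitzBoundary Ω) {x : Plane} (hx : x ∈ closure Ω) : ∃ U, IsPatch Ω U ∧ x ∈ U := by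
  by_cases hxΩ : x ∈ Ω
  · exact ⟨Ω, isPatch_self hΩ hb, hxΩ⟩
  · have hxf : x ∈ frontier Ω := by
      rw [hΩ.frontier_eq]
      exact ⟨hx, hxΩ⟩
    obtain ⟨Φ, K, g, hg, hev⟩ := hl x hxf
    obtain ⟨ε, hε, hball⟩ := Metric.eventually_nhds_iff_ball.1 hev
    exact ⟨Metric.ball x ε, IsGraphChart.isPatch ⟨hg, Metric.isOpen_ball, hball⟩ hΩ
      Metric.isBounded_ball, Metric.mem_ball_self hε⟩

/-- A finite smooth partition of unity on the closure of `Ω`, with supports in patches. -/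
structure PatchPartition (Ω : Set Plane) (ι : Type) [Fintype ι] where
  U : ι → Set Plane
  ζ : ι → Plane → ℝ
  isPatch : ∀ i, IsPatch Ω (U i)
  contDiff : ∀ i, ContDiff ℝ ∞ (ζ i)
  tsupport_subset : ∀ i, tsupport (ζ i) ⊆ U i
  nonneg : ∀ i x, 0 ≤ ζ i x
  sum_eq_one : ∀ x ∈ closure Ω, ∑ i, ζ i x = 1

theorem exists_patchPartition {Ω : Set Plane} (hΩ : IsOpen Ω) (hb : Bornology.IsBounded Ω)
    (hl : HasLipschitzBoundary Ω) :
    ∃ (ι : Type) (_ : Fintype ι), Nonempty (PatchPartition Ω ι) := by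
  choose! U hU hxU using fun x (hx : x ∈ closure Ω) => exists_isPatch hΩ hb hl hx
  obtain ⟨t, ht, hcov⟩ := hb.isCompact_closure.elim_nhds_subcover U
    fun x hx => (hU x hx).isOpen.mem_nhds (hxU x hx)
  refine ⟨t, inferInstance, ?_⟩
  obtain ⟨f, hf⟩ := SmoothPartitionOfUnity.exists_isSubordinate 𝓘(ℝ, Plane)
    (isClosed_closure (s := Ω)) (fun i : t => U i) (fun i => (hU i (ht i i.2)).isOpen)
    (by simpa [iUnion_subtype] using hcov)
  refine ⟨⟨fun i => U i, fun i => f i, fun i => hU i (ht i i.2), fun i => (f i).contMDiff.contDiff,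
    hf, f.nonneg, fun x hx => ?_⟩⟩
  rw [← f.sum_eq_one hx, finsum_eq_sum_of_fintype]

namespace PatchPartition

variable {Ω : Set Plane} {ι : Type} [Fintype ι] (p : PatchPartition Ω ι)

theorem closure_subset : closure Ω ⊆ ⋃ i, p.U i := by
  intro x hx
  by_contra hn
  have h0 : ∀ i, p.ζ i x = 0 := fun i => image_eq_zero_of_notMem_tsupport fun h =>
    hn (mem_iUnion.2 ⟨i, p.tsupport_subset i h⟩)
  have := p.sum_eq_one x hx
  simp [h0] at this

end PatchPartition

/-- The left side is the derivative of ζ f² in the direction (c, d), with z = ζ, z' its directional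
derivative, s = f and (a, b) = ∇f. Cauchy–Schwarz bounds the directional derivative q of f, and 2sq
≤ s² + q² in absolute value. -/
theorem leibniz_square_bound {A B z z' : ℝ} (hz : |z| ≤ A) (hz' : |z'| ≤ B) (s a b c d : ℝ) :
    z' * s ^ 2 + z * (2 * s * (c * a + d * b)) ≤
      (B + A + A * (c ^ 2 + d ^ 2)) * (s ^ 2 + (a ^ 2 + b ^ 2)) := by
  have hA : 0 ≤ A := (abs_nonneg _).trans hz
  have hB : 0 ≤ B := (abs_nonneg _).trans hz'
  set q := c * a + d * b with hq
  have hqs : q ^ 2 ≤ (c ^ 2 + d ^ 2) * (a ^ 2 + b ^ 2) := by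
    rw [hq]
    nlinarith [sq_nonneg (c * b - d * a)]
  have h1 : z' * s ^ 2 ≤ B * s ^ 2 :=
    mul_le_mul_of_nonneg_right ((le_abs_self _).trans hz') (sq_nonneg _)
  have h2 : z * (2 * s * q) ≤ A * (s ^ 2 + q ^ 2) := by
    have h3 : |2 * s * q| ≤ s ^ 2 + q ^ 2 :=
      abs_le.2 ⟨by nlinarith [sq_nonneg (s + q)], by nlinarith [sq_nonneg (s - q)]⟩
    refine (le_abs_self _).trans ?_
    rw [abs_mul]
    exact mul_le_mul hz h3 (abs_nonneg _) hA
  have h4 := mul_le_mul_of_nonneg_left hqs hA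
  have h5 : 0 ≤ (a ^ 2 + b ^ 2) * (B + A) := by positivity
  have h6 : 0 ≤ A * (c ^ 2 + d ^ 2) * s ^ 2 := by positivity
  linarith

namespace PatchPartition

variable {Ω : Set Plane} {ι : Type} [Fintype ι]

theorem hasCompactSupport (p : PatchPartition Ω ι) (i : ι) : HasCompactSupport (p.ζ i) :=
  Metric.isCompact_of_isClosed_isBounded (isClosed_tsupport _)
    ((p.isPatch i).bounded.subset (p.tsupport_subset i))

theorem frontier_subset (p : PatchPartition Ω ι) : frontier Ω ⊆ ⋃ i, p.U i :=
  frontier_subset_closure.trans p.closure_subset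

theorem isFiniteMeasure_boundaryMeasure (p : PatchPartition Ω ι) :
    IsFiniteMeasure (boundaryMeasure Ω) := by
  refine ⟨?_⟩
  have h1 : boundaryMeasure Ω univ = boundaryMeasure Ω (frontier Ω) := by
    rw [boundaryMeasure, Measure.restrict_apply_univ, Measure.restrict_apply_self]
  rw [h1]
  refine (measure_mono p.frontier_subset).trans_lt ((measure_iUnion_fintype_le _ _).trans_lt ?_)
  exact ENNReal.sum_lt_top.2 fun i _ => (p.isPatch i).boundaryMeasure_lt_top

theorem aestronglyMeasurable_outwardNormal (p : PatchPartition Ω ι) :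
    AEStronglyMeasurable (outwardNormal Ω) (boundaryMeasure Ω) := by
  have h : boundaryMeasure Ω = (boundaryMeasure Ω).restrict (⋃ i, p.U i) := by
    refine (Measure.restrict_eq_self_of_ae_mem ?_).symm
    filter_upwards [ae_restrict_mem isClosed_frontier.measurableSet] with y hy
    exact p.frontier_subset hy
  rw [h, aestronglyMeasurable_iUnion_iff]
  exact fun i => (p.isPatch i).aestronglyMeasurable_normal

theorem contDiff_mul (p : PatchPartition Ω ι) {f : Plane → ℝ} (hf : ContDiff ℝ 1 f) (i : ι) :
    ContDiff ℝ 1 fun y => p.ζ i y * f y :=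
  ((p.contDiff i).of_le (by exact_mod_cast le_top)).mul hf

theorem hasCompactSupport_mul (p : PatchPartition Ω ι) (f : Plane → ℝ) (i : ι) :
    HasCompactSupport fun y => p.ζ i y * f y := (p.hasCompactSupport i).mul_right

theorem tsupport_mul_subset (p : PatchPartition Ω ι) (f : Plane → ℝ) (i : ι) :
    tsupport (fun y => p.ζ i y * f y) ⊆ p.U i :=
  (tsupport_mul_subset_left (f := p.ζ i) (g := f)).trans (p.tsupport_subset i)

theorem ae_boundary_sum_eq_one (p : PatchPartition Ω ι) :
    ∀ᵐ y ∂boundaryMeasure Ω, ∑ i, p.ζ i y = 1 := by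
  filter_upwards [ae_restrict_mem isClosed_frontier.measurableSet] with y hy
  exact p.sum_eq_one y (frontier_subset_closure hy)

theorem integrable_mul_inner_normal (p : PatchPartition Ω ι) {f : Plane → ℝ}
    (hf : Integrable f (boundaryMeasure Ω))
    (v : Plane) :
    Integrable (fun y => f y * inner ℝ v (outwardNormal Ω y)) (boundaryMeasure Ω) := by
  refine hf.mul_bdd (c := ‖v‖)
    ((continuous_const.inner continuous_id).comp_aestronglyMeasurable
      p.aestronglyMeasurable_outwardNormal) (Eventually.of_forall fun y => ?_)
  refine (norm_inner_le_norm v _).trans ?_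
  exact mul_le_of_le_one_right (norm_nonneg v) (norm_outwardNormal_le Ω y)

/-- The divergence theorem on a bounded Lipschitz domain. -/
theorem setIntegral_fderiv_eq_boundary (p : PatchPartition Ω ι) (hΩ : IsOpen Ω) {f : Plane → ℝ}
    (hf : ContDiff ℝ 1 f)
    (v : Plane) :
    ∫ y in Ω, fderiv ℝ f y v =
      ∫ y, f y * inner ℝ v (outwardNormal Ω y) ∂boundaryMeasure Ω := by
  have := p.isFiniteMeasure_boundaryMeasure
  have h1 : ∫ y in Ω, fderiv ℝ f y v =
      ∫ y in Ω, ∑ i, fderiv ℝ (fun y => p.ζ i y * f y) y v := by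
    refine setIntegral_congr_fun hΩ.measurableSet fun y hy => ?_
    -- The partition sums to one only on the closure, but y has a whole neighbourhood in Ω, so the
    -- identity may be differentiated at y.
    have heq : f =ᶠ[𝓝 y] fun y => ∑ i, p.ζ i y * f y := by
      filter_upwards [hΩ.mem_nhds hy] with z hz
      rw [← Finset.sum_mul, p.sum_eq_one z (subset_closure hz), one_mul]
    rw [heq.fderiv_eq, fderiv_fun_sum fun i _ =>
      (p.contDiff_mul hf i).differentiable one_ne_zero y, _root_.sum_apply]
  have h2 : ∫ y, f y * inner ℝ v (outwardNormal Ω y) ∂boundaryMeasure Ω =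
      ∫ y, ∑ i, (p.ζ i y * f y) * inner ℝ v (outwardNormal Ω y) ∂boundaryMeasure Ω := by
    refine integral_congr_ae ?_
    filter_upwards [p.ae_boundary_sum_eq_one] with y hy
    rw [← Finset.sum_mul, ← Finset.sum_mul, hy, one_mul]
  rw [h1, h2, integral_finsetSum, integral_finsetSum]
  · exact Finset.sum_congr rfl fun i _ => (p.isPatch i).divergence _ (p.contDiff_mul hf i)
      (p.hasCompactSupport_mul f i) (p.tsupport_mul_subset f i) v
  · exact fun i _ => p.integrable_mul_inner_normal
      ((p.contDiff_mul hf i).continuous.integrable_of_hasCompactSupport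
        (p.hasCompactSupport_mul f i)) v
  · exact fun i _ => ((((p.contDiff_mul hf i).continuous_fderiv one_ne_zero).clm_apply
      continuous_const).integrable_of_hasCompactSupport
        ((p.hasCompactSupport_mul f i).fderiv_apply ℝ v)).integrableOn

theorem integrableOn_of_continuous (hb : Bornology.IsBounded Ω) {f : Plane → ℝ}
    (hf : Continuous f) : IntegrableOn f Ω :=
  (hf.continuousOn.integrableOn_compact hb.isCompact_closure).mono_set subset_closure

/-- The trace inequality on a bounded Lipschitz domain, for smooth functions. -/
theorem exists_trace_le (p : PatchPartition Ω ι) (hb : Bornology.IsBounded Ω) :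
    ∃ C : ℝ, 0 ≤ C ∧ ∀ f : Plane → ℝ, ContDiff ℝ ∞ f →
      ∫ y, f y ^ 2 ∂boundaryMeasure Ω ≤
        C * ∫ y in Ω, (f y ^ 2 + ∑ i, partialDeriv i f y ^ 2) := by
  have := p.isFiniteMeasure_boundaryMeasure
  have hi : ∀ i, ∃ C : ℝ, 0 ≤ C ∧ ∀ f : Plane → ℝ, ContDiff ℝ ∞ f →
      ∫ y, p.ζ i y * f y ^ 2 ∂boundaryMeasure Ω ≤
        C * ∫ y in Ω, (f y ^ 2 + ∑ i, partialDeriv i f y ^ 2) := by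
    intro i
    obtain ⟨C, hC, e, h⟩ := (p.isPatch i).trace_le
    have hζ : ContDiff ℝ 1 (p.ζ i) := (p.contDiff i).of_le (by exact_mod_cast le_top)
    obtain ⟨A, hA⟩ := (p.hasCompactSupport i).exists_bound_of_continuous hζ.continuous
    obtain ⟨B, hB⟩ := ((p.hasCompactSupport i).fderiv_apply ℝ e).exists_bound_of_continuous
      ((hζ.continuous_fderiv one_ne_zero).clm_apply continuous_const)
    have hA0 : 0 ≤ A := (norm_nonneg _).trans (hA 0)
    have hB0 : 0 ≤ B := (norm_nonneg _).trans (hB 0)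
    refine ⟨C * (B + A + A * ‖e‖ ^ 2), by positivity, fun f hf => ?_⟩
    have hf1 : ContDiff ℝ 1 f := hf.of_le (by exact_mod_cast le_top)
    have hf2 : ContDiff ℝ 1 fun y => f y ^ 2 := hf1.pow 2
    refine (h _ (p.contDiff_mul hf2 i) (p.hasCompactSupport_mul _ i) (p.tsupport_mul_subset _ i)
      fun y => mul_nonneg (p.nonneg i y) (sq_nonneg _)).trans ?_
    rw [mul_assoc]
    refine mul_le_mul_of_nonneg_left ?_ hC
    rw [← integral_const_mul]
    have hpd : ∀ j, Continuous (partialDeriv j f) := fun j =>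
      (hf1.continuous_fderiv one_ne_zero).clm_apply continuous_const
    refine setIntegral_mono
      (integrableOn_of_continuous hb ((p.contDiff_mul hf2 i).continuous_fderiv one_ne_zero
        |>.clm_apply continuous_const))
      (integrableOn_of_continuous hb (by have := hf.continuous; fun_prop)) fun y => ?_
    simp only
    have hdf : HasFDerivAt f (fderiv ℝ f y) y := (hf1.differentiable one_ne_zero y).hasFDerivAt
    have hdζ : HasFDerivAt (p.ζ i) (fderiv ℝ (p.ζ i) y) y :=
      (hζ.differentiable one_ne_zero y).hasFDerivAt
    have hd2 : HasFDerivAt (fun y => f y ^ 2) ((2 * f y) • fderiv ℝ f y) y := by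
      simpa using hdf.pow 2
    rw [(hdζ.fun_mul hd2).fderiv]
    have hfe : fderiv ℝ f y e = e 0 * partialDeriv 0 f y + e 1 * partialDeriv 1 f y := by
      have he : e = e 0 • EuclideanSpace.single 0 1 + e 1 • EuclideanSpace.single 1 1 := by
        ext k
        fin_cases k <;> simp
      conv_lhs => rw [he]
      rw [map_add, map_smul, map_smul]
      rfl
    simp only [_root_.add_apply, _root_.smul_apply, smul_eq_mul,
      Fin.sum_univ_two, hfe, EuclideanSpace.norm_sq_eq, Real.norm_eq_abs, sq_abs]
    have := leibniz_square_bound (hA y) (hB y) (f y) (partialDeriv 0 f y)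
      (partialDeriv 1 f y) (e 0) (e 1)
    refine le_trans (le_of_eq ?_) this
    ring
  choose C hC h using hi
  refine ⟨∑ i, C i, Finset.sum_nonneg fun i _ => hC i, fun f hf => ?_⟩
  have h2 : ∫ y, f y ^ 2 ∂boundaryMeasure Ω =
      ∫ y, ∑ i, (p.ζ i y * f y ^ 2) ∂boundaryMeasure Ω := by
    refine integral_congr_ae ?_
    filter_upwards [p.ae_boundary_sum_eq_one] with y hy
    rw [← Finset.sum_mul, hy, one_mul]
  rw [h2, integral_finsetSum, Finset.sum_mul]
  · exact Finset.sum_le_sum fun i _ => h i f hf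
  · exact fun i _ => ((p.contDiff i).continuous.mul (hf.continuous.pow 2)
      ).integrable_of_hasCompactSupport (p.hasCompactSupport_mul _ i)

end PatchPartition

/-! ### Multiplication by a bounded function on `L²` -/

section Multiplication

variable {α : Type*} {mα : MeasurableSpace α} {μ : Measure α} {c : α → ℝ}

/-- An essentially bounded measurable function. -/
structure IsEssBounded (μ : Measure α) (c : α → ℝ) : Prop where
  aestronglyMeasurable : AEStronglyMeasurable c μ
  exists_bound : ∃ C : ℝ, 0 ≤ C ∧ ∀ᵐ x ∂μ, ‖c x‖ ≤ C

theorem IsEssBounded.memLp_mul (hc : IsEssBounded μ c) (f : Lp ℝ 2 μ) :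
    MemLp (fun x => c x * f x) 2 μ := by
  obtain ⟨C, -, hC⟩ := hc.exists_bound
  refine (Lp.memLp f).of_le_mul (c := C)
    (hc.aestronglyMeasurable.mul (Lp.memLp f).aestronglyMeasurable) ?_
  filter_upwards [hC] with x hx
  rw [norm_mul]
  gcongr

/-- Multiplication by an essentially bounded function, as an operator on `L²`. -/
noncomputable def mulLp (hc : IsEssBounded μ c) : Lp ℝ 2 μ →L[ℝ] Lp ℝ 2 μ :=
  LinearMap.mkContinuousOfExistsBound
    { toFun := fun f => (hc.memLp_mul f).toLp
      map_add' := fun f g => by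
        refine Lp.ext ?_
        filter_upwards [(hc.memLp_mul (f + g)).coeFn_toLp, (hc.memLp_mul f).coeFn_toLp,
          (hc.memLp_mul g).coeFn_toLp, Lp.coeFn_add f g,
          Lp.coeFn_add (hc.memLp_mul f).toLp (hc.memLp_mul g).toLp] with x h1 h2 h3 h4 h5
        rw [h1, h5, Pi.add_apply, h2, h3, h4, Pi.add_apply, mul_add]
      map_smul' := fun r f => by
        refine Lp.ext ?_
        filter_upwards [(hc.memLp_mul (r • f)).coeFn_toLp, (hc.memLp_mul f).coeFn_toLp,
          Lp.coeFn_smul r f, Lp.coeFn_smul r (hc.memLp_mul f).toLp] with x h1 h2 h3 h4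
        rw [h1, RingHom.id_apply, h4, Pi.smul_apply, h2, h3, Pi.smul_apply, smul_eq_mul,
          smul_eq_mul]
        ring }
    (by
      obtain ⟨C, -, hC⟩ := hc.exists_bound
      refine ⟨C, fun f => Lp.norm_le_mul_norm_of_ae_le_mul ?_⟩
      filter_upwards [hC, (hc.memLp_mul f).coeFn_toLp] with x hx h1
      change ‖((hc.memLp_mul f).toLp (fun x => c x * f x) : α → ℝ) x‖ ≤ _
      rw [h1, norm_mul]
      gcongr)

theorem coeFn_mulLp (hc : IsEssBounded μ c) (f : Lp ℝ 2 μ) :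
    mulLp hc f =ᵐ[μ] fun x => c x * f x := (hc.memLp_mul f).coeFn_toLp

theorem L2_inner_eq (f g : Lp ℝ 2 μ) : inner ℝ f g = ∫ x, f x * g x ∂μ := by
  rw [L2.inner_def]
  simp [mul_comm]

theorem L2_integrable_mul (f g : Lp ℝ 2 μ) : Integrable (fun x => f x * g x) μ := by
  have := L2.integrable_inner (𝕜 := ℝ) f g
  simpa [mul_comm] using this

theorem inner_mulLp_left (hc : IsEssBounded μ c) (f g : Lp ℝ 2 μ) :
    inner ℝ (mulLp hc f) g = inner ℝ f (mulLp hc g) := by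
  rw [L2_inner_eq, L2_inner_eq]
  refine integral_congr_ae ?_
  filter_upwards [coeFn_mulLp hc f, coeFn_mulLp hc g] with x h1 h2
  rw [h1, h2]
  ring

end Multiplication

/-! ### Traces -/

/-- A linear relation between Banach spaces that is densely defined and bounded is, up to closure,
the graph of a continuous linear map. -/
theorem exists_clm_of_closure_graph {E F : Type*} [NormedAddCommGroup E] [NormedSpace ℝ E]
    [CompleteSpace E] [NormedAddCommGroup F] [NormedSpace ℝ F] [CompleteSpace F]
    {W : Submodule ℝ (E × F)} {C : ℝ} (hC0 : 0 ≤ C)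
    (hC : ∀ q ∈ W.topologicalClosure, ‖q.2‖ ≤ C * ‖q.1‖) (hW : Dense {u | ∃ τ, (u, τ) ∈ W}) :
    ∃ T : E →L[ℝ] F, ∀ u τ, (u, τ) ∈ W.topologicalClosure ↔ T u = τ := by
  have huniq : ∀ {u τ τ'}, (u, τ) ∈ W.topologicalClosure → (u, τ') ∈ W.topologicalClosure →
      τ = τ' := by
    intro u τ τ' hτ hτ'
    have := hC _ (W.topologicalClosure.sub_mem hτ hτ')
    simp only [Prod.mk_sub_mk, sub_self, norm_zero, mul_zero] at this
    exact sub_eq_zero.1 (norm_le_zero_iff.1 this)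
  have : CompleteSpace W.topologicalClosure := W.isClosed_topologicalClosure.completeSpace_coe
  set π : W.topologicalClosure →L[ℝ] E :=
    (ContinuousLinearMap.fst ℝ E F).comp W.topologicalClosure.subtypeL
  -- The bound makes the projection of the closed graph to E bounded below, so its range is closed;
  -- being also dense, it is everything.
  have hanti : AntilipschitzWith (Real.toNNReal (1 + C)) π := by
    refine AddMonoidHomClass.antilipschitz_of_bound π fun q => ?_
    rw [Real.coe_toNNReal _ (by linarith)]
    have h1 := hC q.1 q.2
    change max ‖q.1.1‖ ‖q.1.2‖ ≤ (1 + C) * ‖q.1.1‖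
    have h0 := norm_nonneg q.1.1
    have h2 := mul_nonneg hC0 h0
    exact max_le (by linarith) (by linarith)
  have hclosed : IsClosed (range π) := hanti.isClosed_range π.uniformContinuous
  have hdense : Dense (range π) := by
    refine hW.mono ?_
    rintro v ⟨τ, hτ⟩
    exact ⟨⟨(v, τ), W.le_topologicalClosure hτ⟩, rfl⟩
  have hex : ∀ u, ∃ τ, (u, τ) ∈ W.topologicalClosure := by
    intro u
    have hu : u ∈ range π := by
      rw [hclosed.closure_eq.symm.trans hdense.closure_eq]
      trivial
    obtain ⟨q, rfl⟩ := hu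
    exact ⟨q.1.2, q.2⟩
  choose T hT using hex
  refine ⟨LinearMap.mkContinuous
    { toFun := T
      map_add' := fun u v =>
        huniq (hT (u + v)) (W.topologicalClosure.add_mem (hT u) (hT v))
      map_smul' := fun c u => huniq (hT (c • u)) (W.topologicalClosure.smul_mem c (hT u)) }
    C fun u => hC _ (hT u), fun u τ => ⟨fun h => huniq (hT u) h, ?_⟩⟩
  rintro rfl
  exact hT u

/-- The properties of a bounded Lipschitz domain on which the boundary calculus rests. -/
structure HasBoundaryCalculus (Ω : Set Plane) : Prop where
  isOpen : IsOpen Ω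
  bounded : Bornology.IsBounded Ω
  isFiniteMeasure : IsFiniteMeasure (boundaryMeasure Ω)
  normal : AEStronglyMeasurable (outwardNormal Ω) (boundaryMeasure Ω)
  divergence : ∀ f : Plane → ℝ, ContDiff ℝ 1 f → ∀ v, ∫ y in Ω, fderiv ℝ f y v =
    ∫ y, f y * inner ℝ v (outwardNormal Ω y) ∂boundaryMeasure Ω
  trace_le : ∃ C : ℝ, 0 ≤ C ∧ ∀ f : Plane → ℝ, ContDiff ℝ ∞ f →
    ∫ y, f y ^ 2 ∂boundaryMeasure Ω ≤
      C * ∫ y in Ω, (f y ^ 2 + ∑ i, partialDeriv i f y ^ 2)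

theorem HasLipschitzBoundary.hasBoundaryCalculus {Ω : Set Plane} (hl : HasLipschitzBoundary Ω)
    (hΩ : IsOpen Ω) (hb : Bornology.IsBounded Ω) : HasBoundaryCalculus Ω := by
  obtain ⟨ι, _, ⟨p⟩⟩ := exists_patchPartition hΩ hb hl
  exact ⟨hΩ, hb, p.isFiniteMeasure_boundaryMeasure, p.aestronglyMeasurable_outwardNormal,
    fun f hf v => p.setIntegral_fderiv_eq_boundary hΩ hf v, p.exists_trace_le hb⟩

theorem continuous_partialDeriv {f : Plane → ℝ} (hf : ContDiff ℝ ∞ f) (i : Fin 2) :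
    Continuous (partialDeriv i f) :=
  (hf.continuous_fderiv (by simp)).clm_apply continuous_const

theorem partialDeriv_add {f g : Plane → ℝ} (hf : ContDiff ℝ ∞ f) (hg : ContDiff ℝ ∞ g)
    (i : Fin 2) : partialDeriv i (f + g) = partialDeriv i f + partialDeriv i g := by
  funext x
  simp [partialDeriv, fderiv_add (hf.differentiable (by simp) x) (hg.differentiable (by simp) x)]

theorem partialDeriv_smul {f : Plane → ℝ} (hf : ContDiff ℝ ∞ f) (c : ℝ) (i : Fin 2) :
    partialDeriv i (c • f) = c • partialDeriv i f := by
  funext x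
  simp [partialDeriv, fderiv_const_smul (hf.differentiable (by simp) x)]

theorem IsJetOf.add {Ω : Set Plane} {u v : L2 Ω × (Fin 2 → L2 Ω)} {f g : Plane → ℝ}
    (hu : IsJetOf Ω u f) (hv : IsJetOf Ω v g) (hf : ContDiff ℝ ∞ f) (hg : ContDiff ℝ ∞ g) :
    IsJetOf Ω (u + v) (f + g) := by
  refine ⟨(Lp.coeFn_add u.1 v.1).trans (hu.1.add hv.1), fun i => ?_⟩
  rw [partialDeriv_add hf hg]
  exact (Lp.coeFn_add (u.2 i) (v.2 i)).trans ((hu.2 i).add (hv.2 i))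

theorem IsJetOf.smul {Ω : Set Plane} {u : L2 Ω × (Fin 2 → L2 Ω)} {f : Plane → ℝ}
    (hu : IsJetOf Ω u f) (hf : ContDiff ℝ ∞ f) (c : ℝ) : IsJetOf Ω (c • u) (c • f) := by
  refine ⟨(Lp.coeFn_smul c u.1).trans (hu.1.const_smul c), fun i => ?_⟩
  rw [partialDeriv_smul hf]
  exact (Lp.coeFn_smul c (u.2 i)).trans ((hu.2 i).const_smul c)

theorem IsJetOf.zero (Ω : Set Plane) : IsJetOf Ω 0 0 := by
  refine ⟨Lp.coeFn_zero ℝ 2 _, fun i => ?_⟩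
  have h : partialDeriv i (0 : Plane → ℝ) = 0 := by
    funext x
    simp [partialDeriv]
  rw [h]
  exact Lp.coeFn_zero ℝ 2 _

/-- The functions that are smooth up to the boundary are dense in `H¹`. -/
theorem dense_smooth (Ω : Set Plane) :
    Dense {u : H1 Ω | ∃ f : Plane → ℝ, ContDiff ℝ ∞ f ∧ IsJetOf Ω u f} := by
  intro u
  rw [closure_subtype]
  refine closure_mono ?_ u.2
  intro v hv
  exact ⟨⟨v, (smoothJets Ω).le_topologicalClosure hv⟩, hv, rfl⟩

/-- The pairs `(u, u|∂Ω)` with `u` smooth up to the boundary. -/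
def smoothTraces (Ω : Set Plane) : Submodule ℝ (H1 Ω × L2Boundary Ω) where
  carrier := {q | ∃ f : Plane → ℝ, ContDiff ℝ ∞ f ∧
    IsJetOf Ω q.1 f ∧ (q.2 : Plane → ℝ) =ᵐ[boundaryMeasure Ω] f}
  add_mem' := by
    rintro q r ⟨f, hf, hq, hq'⟩ ⟨g, hg, hr, hr'⟩
    exact ⟨f + g, hf.add hg, hq.add hr hf hg, (Lp.coeFn_add q.2 r.2).trans (hq'.add hr')⟩
  zero_mem' := ⟨0, contDiff_const, IsJetOf.zero Ω, Lp.coeFn_zero ℝ 2 _⟩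
  smul_mem' := by
    rintro c q ⟨f, hf, hq, hq'⟩
    exact ⟨c • f, hf.const_smul c, hq.smul hf c,
      (Lp.coeFn_smul c q.2).trans (hq'.const_smul c)⟩

/-- Exhibits the trace relation as a closed linear relation, to which `exists_clm_of_closure_graph`
applies. -/
theorem isTrace_iff {Ω : Set Plane} {u : H1 Ω} {τ : L2Boundary Ω} :
    IsTrace Ω u τ ↔ (u, τ) ∈ (smoothTraces Ω).topologicalClosure := Iff.rfl

theorem norm_val_le {Ω : Set Plane} (u : H1 Ω) : ‖u.val‖ ≤ ‖u‖ :=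
  norm_fst_le (u : L2 Ω × (Fin 2 → L2 Ω))

theorem norm_partial_le {Ω : Set Plane} (u : H1 Ω) (i : Fin 2) : ‖u.partial i‖ ≤ ‖u‖ :=
  (norm_le_pi_norm (u : L2 Ω × (Fin 2 → L2 Ω)).2 i).trans
    (norm_snd_le (u : L2 Ω × (Fin 2 → L2 Ω)))

namespace HasBoundaryCalculus

variable {Ω : Set Plane}

theorem memLp_of_continuous (h : HasBoundaryCalculus Ω) {f : Plane → ℝ} (hf : Continuous f) :
    MemLp f 2 (volume.restrict Ω) := by
  have : IsFiniteMeasure ((volume : Measure Plane).restrict Ω) :=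
    ⟨by simpa using h.bounded.measure_lt_top⟩
  obtain ⟨C, hC⟩ := h.bounded.isCompact_closure.exists_bound_of_continuousOn hf.continuousOn
  refine MemLp.of_bound hf.aestronglyMeasurable C ?_
  filter_upwards [ae_restrict_mem h.isOpen.measurableSet] with x hx
  exact hC x (subset_closure hx)

theorem memLp_boundary_of_continuous (h : HasBoundaryCalculus Ω) {f : Plane → ℝ}
    (hf : Continuous f) : MemLp f 2 (boundaryMeasure Ω) := by
  have := h.isFiniteMeasure
  obtain ⟨C, hC⟩ := h.bounded.isCompact_closure.exists_bound_of_continuousOn hf.continuousOn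
  refine MemLp.of_bound hf.aestronglyMeasurable C ?_
  filter_upwards [ae_restrict_mem isClosed_frontier.measurableSet] with x hx
  exact hC x (frontier_subset_closure hx)

theorem exists_isJetOf (h : HasBoundaryCalculus Ω) {f : Plane → ℝ} (hf : ContDiff ℝ ∞ f) :
    ∃ u : H1 Ω, IsJetOf Ω u f := by
  set u : L2 Ω × (Fin 2 → L2 Ω) := ((h.memLp_of_continuous hf.continuous).toLp,
    fun i => (h.memLp_of_continuous (continuous_partialDeriv hf i)).toLp)
  have hu : IsJetOf Ω u f := ⟨(h.memLp_of_continuous hf.continuous).coeFn_toLp,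
    fun i => (h.memLp_of_continuous (continuous_partialDeriv hf i)).coeFn_toLp⟩
  exact ⟨⟨u, (smoothJets Ω).le_topologicalClosure ⟨f, hf, hu⟩⟩, hu⟩

theorem exists_norm_trace_le (h : HasBoundaryCalculus Ω) :
    ∃ C : ℝ, 0 ≤ C ∧ ∀ q ∈ (smoothTraces Ω).topologicalClosure, ‖q.2‖ ≤ C * ‖q.1‖ := by
  obtain ⟨C, hC, hle⟩ := h.trace_le
  refine ⟨√(3 * C), Real.sqrt_nonneg _, fun q hq => ?_⟩
  -- The inequality is a closed condition, so smooth pairs suffice. The 3 arises because the norm of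
  -- H¹ is a maximum: u and its two partial derivatives are each bounded by it.
  have hclosed : IsClosed {q : H1 Ω × L2Boundary Ω | ‖q.2‖ ≤ √(3 * C) * ‖q.1‖} :=
    isClosed_le (by fun_prop) (by fun_prop)
  refine closure_minimal ?_ hclosed hq
  rintro ⟨u, τ⟩ ⟨f, hf, hu, hτ⟩
  simp only at hu hτ
  have h1 : ‖τ‖ ^ 2 = ∫ y, f y ^ 2 ∂boundaryMeasure Ω := by
    rw [← real_inner_self_eq_norm_sq, L2_inner_eq]
    refine integral_congr_ae ?_
    filter_upwards [hτ] with y hy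
    rw [hy, sq]
  have hsq : ∀ {w : L2 Ω} {k : Plane → ℝ}, (w : Plane → ℝ) =ᵐ[volume.restrict Ω] k →
      Integrable (fun y => k y ^ 2) (volume.restrict Ω) ∧ ∫ y in Ω, k y ^ 2 = ‖w‖ ^ 2 := by
    intro w k hk
    have he : (fun y => w y * w y) =ᵐ[volume.restrict Ω] fun y => k y ^ 2 := by
      filter_upwards [hk] with y hy
      rw [hy, sq]
    refine ⟨(L2_integrable_mul w w).congr he, ?_⟩
    rw [← real_inner_self_eq_norm_sq, L2_inner_eq]
    exact (integral_congr_ae he).symm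
  have h2 : ∫ y in Ω, (f y ^ 2 + ∑ i, partialDeriv i f y ^ 2) ≤ 3 * ‖u‖ ^ 2 := by
    rw [integral_add (hsq hu.1).1 (integrable_finsetSum _ fun i _ => (hsq (hu.2 i)).1),
      integral_finsetSum _ fun i _ => (hsq (hu.2 i)).1, (hsq hu.1).2, Fin.sum_univ_two,
      (hsq (hu.2 0)).2, (hsq (hu.2 1)).2]
    have e0 := pow_le_pow_left₀ (norm_nonneg _) (norm_val_le u) 2
    have e1 := pow_le_pow_left₀ (norm_nonneg _) (norm_partial_le u 0) 2
    have e2 := pow_le_pow_left₀ (norm_nonneg _) (norm_partial_le u 1) 2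
    rw [H1.val] at e0
    rw [H1.partial] at e1 e2
    linarith
  have h3 : ‖τ‖ ^ 2 ≤ (√(3 * C) * ‖u‖) ^ 2 := by
    rw [mul_pow, Real.sq_sqrt (by positivity), h1]
    refine (hle f hf).trans ?_
    calc C * _ ≤ C * (3 * ‖u‖ ^ 2) := mul_le_mul_of_nonneg_left h2 hC
      _ = 3 * C * ‖u‖ ^ 2 := by ring
  exact le_of_sq_le_sq h3 (by positivity)

theorem exists_isTrace_of_isJetOf (h : HasBoundaryCalculus Ω) {u : H1 Ω} {f : Plane → ℝ}
    (hf : ContDiff ℝ ∞ f) (hu : IsJetOf Ω u f) :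
    ∃ τ : L2Boundary Ω, (u, τ) ∈ smoothTraces Ω ∧ (τ : Plane → ℝ) =ᵐ[boundaryMeasure Ω] f :=
  ⟨(h.memLp_boundary_of_continuous hf.continuous).toLp,
    ⟨f, hf, hu, (h.memLp_boundary_of_continuous hf.continuous).coeFn_toLp⟩,
    (h.memLp_boundary_of_continuous hf.continuous).coeFn_toLp⟩

theorem exists_traceCLM (h : HasBoundaryCalculus Ω) :
    ∃ T : H1 Ω →L[ℝ] L2Boundary Ω, ∀ u τ, IsTrace Ω u τ ↔ T u = τ := by
  obtain ⟨C, hC0, hC⟩ := h.exists_norm_trace_le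
  have : CompleteSpace (H1 Ω) :=
    (smoothJets Ω).isClosed_topologicalClosure.completeSpace_coe
  refine exists_clm_of_closure_graph hC0 hC ((dense_smooth Ω).mono ?_)
  rintro v ⟨f, hf, hv⟩
  obtain ⟨τ, hτ, -⟩ := h.exists_isTrace_of_isJetOf hf hv
  exact ⟨τ, hτ⟩

/-- The trace as a continuous linear map. -/
noncomputable def traceCLM (h : HasBoundaryCalculus Ω) : H1 Ω →L[ℝ] L2Boundary Ω :=
  h.exists_traceCLM.choose

theorem isTrace_iff_traceCLM (h : HasBoundaryCalculus Ω) {u : H1 Ω} {τ : L2Boundary Ω} :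
    IsTrace Ω u τ ↔ h.traceCLM u = τ := h.exists_traceCLM.choose_spec u τ

@[simp] theorem traceCLM_apply (h : HasBoundaryCalculus Ω) (u : H1 Ω) :
    h.traceCLM u = trace u := by
  have hu : ∃ τ, IsTrace Ω u τ := ⟨_, h.isTrace_iff_traceCLM.2 rfl⟩
  rw [trace, dif_pos hu]
  exact h.isTrace_iff_traceCLM.1 hu.choose_spec

theorem trace_of_isJetOf (h : HasBoundaryCalculus Ω) {u : H1 Ω} {f : Plane → ℝ}
    (hf : ContDiff ℝ ∞ f) (hu : IsJetOf Ω u f) :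
    (trace u : Plane → ℝ) =ᵐ[boundaryMeasure Ω] f := by
  obtain ⟨τ, hτ, hτf⟩ := h.exists_isTrace_of_isJetOf hf hu
  rw [← h.traceCLM_apply, h.isTrace_iff_traceCLM.1
    (isTrace_iff.2 ((smoothTraces Ω).le_topologicalClosure hτ))]
  exact hτf

theorem isEssBounded_normal (h : HasBoundaryCalculus Ω) (i : Fin 2) :
    IsEssBounded (boundaryMeasure Ω) fun x => outwardNormal Ω x i := by
  have hi : Continuous fun y : Plane => y i := by fun_prop
  exact ⟨hi.comp_aestronglyMeasurable h.normal, 1, zero_le_one,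
    Eventually.of_forall fun x => (PiLp.norm_apply_le _ i).trans (norm_outwardNormal_le Ω x)⟩

end HasBoundaryCalculus

/-- The function underlying an element of `H¹`, as a continuous linear map. -/
noncomputable def valCLM (Ω : Set Plane) : H1 Ω →L[ℝ] L2 Ω :=
  (ContinuousLinearMap.fst ℝ (L2 Ω) (Fin 2 → L2 Ω)).comp
    (smoothJets Ω).topologicalClosure.subtypeL

@[simp] theorem valCLM_apply {Ω : Set Plane} (u : H1 Ω) : valCLM Ω u = u.val := rfl

/-- The partial derivative on `H¹`, as a continuous linear map. -/
noncomputable def partialCLM (Ω : Set Plane) (i : Fin 2) : H1 Ω →L[ℝ] L2 Ω :=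
  ((ContinuousLinearMap.proj i).comp (ContinuousLinearMap.snd ℝ (L2 Ω) (Fin 2 → L2 Ω))).comp
    (smoothJets Ω).topologicalClosure.subtypeL

@[simp] theorem partialCLM_apply {Ω : Set Plane} (u : H1 Ω) (i : Fin 2) :
    partialCLM Ω i u = u.partial i := rfl

/-! ### Green's formula on H¹ -/

/-- The divergence theorem for the product f g in the i-th coordinate direction. -/
theorem green_smooth {Ω : Set Plane} (h : HasBoundaryCalculus Ω) {u v : H1 Ω}
    {f g : Plane → ℝ} (hf : ContDiff ℝ ∞ f) (hg : ContDiff ℝ ∞ g) (hu : IsJetOf Ω u f)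
    (hv : IsJetOf Ω v g) (i : Fin 2) :
    inner ℝ u.val (v.partial i) + inner ℝ (u.partial i) v.val =
      inner ℝ (trace u) (mulLp (h.isEssBounded_normal i) (trace v)) := by
  have hd := h.divergence (fun y => f y * g y) ((hf.mul hg).of_le (by exact_mod_cast le_top))
    (EuclideanSpace.single i 1)
  rw [L2_inner_eq, L2_inner_eq, ← integral_add (L2_integrable_mul _ _) (L2_integrable_mul _ _),
    L2_inner_eq]
  refine Eq.trans (integral_congr_ae ?_) (hd.trans (integral_congr_ae ?_))
  · filter_upwards [hu.1, hu.2 i, hv.1, hv.2 i] with y h1 h2 h3 h4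
    have e := ((hf.differentiable (by simp) y).hasFDerivAt.fun_mul
      (hg.differentiable (by simp) y).hasFDerivAt).fderiv
    rw [e, H1.val, H1.val, H1.partial, H1.partial, h1, h2, h3, h4]
    simp only [_root_.add_apply, _root_.smul_apply, smul_eq_mul, partialDeriv]
    ring
  · filter_upwards [h.trace_of_isJetOf hf hu, h.trace_of_isJetOf hg hv,
      coeFn_mulLp (h.isEssBounded_normal i) (trace v)] with y h1 h2 h3
    rw [h1, h3, h2, EuclideanSpace.inner_single_left]
    simp
    ring

/-- Green's formula in `H¹`. -/
theorem green {Ω : Set Plane} (h : HasBoundaryCalculus Ω) (u v : H1 Ω) (i : Fin 2) :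
    inner ℝ u.val (v.partial i) + inner ℝ (u.partial i) v.val =
      inner ℝ (trace u) (mulLp (h.isEssBounded_normal i) (trace v)) := by
  -- Both sides are continuous in each argument separately, so density is used in one variable at a
  -- time.
  have step : ∀ g : Plane → ℝ, ContDiff ℝ ∞ g → ∀ v : H1 Ω, IsJetOf Ω v g → ∀ u : H1 Ω,
      inner ℝ u.val (v.partial i) + inner ℝ (u.partial i) v.val =
        inner ℝ (trace u) (mulLp (h.isEssBounded_normal i) (trace v)) := by
    intro g hg v hv u
    have := congrFun (Continuous.ext_on (f := fun u : H1 Ω => inner ℝ (valCLM Ω u) (v.partial i) +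
        inner ℝ (partialCLM Ω i u) v.val)
      (g := fun u => inner ℝ (h.traceCLM u) (mulLp (h.isEssBounded_normal i) (trace v)))
      (dense_smooth Ω) (by fun_prop) (by fun_prop) ?_) u
    · simpa only [valCLM_apply, partialCLM_apply, h.traceCLM_apply] using this
    · rintro u ⟨f, hf, hu⟩
      simpa only [valCLM_apply, partialCLM_apply, h.traceCLM_apply]
        using green_smooth h hf hg hu hv i
  have := congrFun (Continuous.ext_on (f := fun v : H1 Ω => inner ℝ u.val (partialCLM Ω i v) +
      inner ℝ (u.partial i) (valCLM Ω v))
    (g := fun v => inner ℝ (trace u) (mulLp (h.isEssBounded_normal i) (h.traceCLM v)))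
    (dense_smooth Ω) (by fun_prop) (by fun_prop) ?_) v
  · simpa only [valCLM_apply, partialCLM_apply, h.traceCLM_apply] using this
  · rintro v ⟨g, hg, hv⟩
    simpa only [valCLM_apply, partialCLM_apply, h.traceCLM_apply] using step g hg v hv u

/-! ### The Hamiltonian as a quadratic form on `L²` -/

section Coefficients

variable {Ω : Set Plane}

theorem IsEssBounded.mul {α : Type*} {mα : MeasurableSpace α} {μ : Measure α} {c d : α → ℝ}
    (hc : IsEssBounded μ c) (hd : IsEssBounded μ d) : IsEssBounded μ fun x => c x * d x := by
  obtain ⟨C, hC0, hC⟩ := hc.exists_bound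
  obtain ⟨D, hD0, hD⟩ := hd.exists_bound
  refine ⟨hc.aestronglyMeasurable.mul hd.aestronglyMeasurable, C * D, by positivity, ?_⟩
  filter_upwards [hC, hD] with x h1 h2
  rw [norm_mul]
  gcongr

theorem isEssBounded_const {α : Type*} {mα : MeasurableSpace α} (μ : Measure α) (r : ℝ) :
    IsEssBounded μ fun _ => r :=
  ⟨aestronglyMeasurable_const, ‖r‖, norm_nonneg r, Eventually.of_forall fun _ => le_rfl⟩

theorem IsCoefficient.isEssBounded {c : Plane → ℝ} (hc : IsCoefficient Ω c) (hΩ : IsOpen Ω) :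
    IsEssBounded (volume.restrict Ω) c := by
  obtain ⟨hm, m, M, h0, h⟩ := hc
  refine ⟨hm.aestronglyMeasurable, |M|, abs_nonneg M, ?_⟩
  filter_upwards [ae_restrict_mem hΩ.measurableSet] with x hx
  rw [Real.norm_of_nonneg (h0.le.trans (h x hx).1)]
  exact (h x hx).2.trans (le_abs_self M)

theorem IsCoefficient.isEssBounded_inv {c : Plane → ℝ} (hc : IsCoefficient Ω c) (hΩ : IsOpen Ω) :
    IsEssBounded (volume.restrict Ω) fun x => (c x)⁻¹ := by
  obtain ⟨hm, m, M, h0, h⟩ := hc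
  refine ⟨hm.inv.aestronglyMeasurable, m⁻¹, by positivity, ?_⟩
  filter_upwards [ae_restrict_mem hΩ.measurableSet] with x hx
  have := (h x hx).1
  rw [norm_inv, Real.norm_of_nonneg (h0.le.trans this)]
  gcongr

theorem PlateParameters.isEssBounded_momentum (P : PlateParameters Ω)
    (hΩ : IsOpen Ω) :
    IsEssBounded (volume.restrict Ω) fun x => (P.ρ x)⁻¹ * (P.h x)⁻¹ :=
  (P.hρ.isEssBounded_inv hΩ).mul (P.hh.isEssBounded_inv hΩ)

theorem PlateParameters.isEssBounded_angular (P : PlateParameters Ω)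
    (hΩ : IsOpen Ω) :
    IsEssBounded (volume.restrict Ω)
      fun x => 12 * ((P.ρ x)⁻¹ * ((P.h x)⁻¹ * ((P.h x)⁻¹ * (P.h x)⁻¹))) :=
  (isEssBounded_const _ 12).mul ((P.hρ.isEssBounded_inv hΩ).mul
    ((P.hh.isEssBounded_inv hΩ).mul ((P.hh.isEssBounded_inv hΩ).mul
      (P.hh.isEssBounded_inv hΩ))))

theorem PlateParameters.isEssBounded_shear (P : PlateParameters Ω)
    (hΩ : IsOpen Ω) :
    IsEssBounded (volume.restrict Ω) fun x => P.k x * P.G x * P.h x :=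
  ((P.hk.isEssBounded hΩ).mul (P.hG.isEssBounded hΩ)).mul (P.hh.isEssBounded hΩ)

theorem PlateParameters.isEssBounded_stiffness (P : PlateParameters Ω)
    (hΩ : IsOpen Ω) (i j l m : Fin 2) :
    IsEssBounded (volume.restrict Ω) fun x => P.D x i j l m := by
  obtain ⟨C, hC⟩ := P.D_bound
  refine ⟨(P.D_meas i j l m).aestronglyMeasurable, |C|, abs_nonneg C, ?_⟩
  filter_upwards [ae_restrict_mem hΩ.measurableSet] with x hx
  exact (hC x hx i j l m).trans (le_abs_self C)

end Coefficients

variable {Ω : Set Plane}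

/-- The shear deformation as an element of `L²`. -/
noncomputable def shearStrainL2 (a : PlateState Ω) (i : Fin 2) : L2 Ω :=
  a.w.partial i - (a.φ i).val

/-- The symmetric gradient as an element of `L²`. -/
noncomputable def symGradL2 (φ : Fin 2 → H1 Ω) (i j : Fin 2) : L2 Ω :=
  (1 / 2 : ℝ) • ((φ j).partial i + (φ i).partial j)

/-- The shear force as an element of `L²`. -/
noncomputable def shearForceL2 (P : PlateParameters Ω) (hΩ : IsOpen Ω) (a : PlateState Ω)
    (i : Fin 2) : L2 Ω :=
  mulLp (P.isEssBounded_shear hΩ) (shearStrainL2 a i)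

/-- The stiffness tensor applied to a tensor field in `L²`. -/
noncomputable def stiffnessL2 (P : PlateParameters Ω) (hΩ : IsOpen Ω)
    (E : Fin 2 → Fin 2 → L2 Ω) (i j : Fin 2) : L2 Ω :=
  ∑ l, ∑ m, mulLp (P.isEssBounded_stiffness hΩ i j l m) (E l m)

theorem coeFn_sum_two {α : Type*} {mα : MeasurableSpace α} {μ : Measure α}
    (f : Fin 2 → Lp ℝ 2 μ) : (∑ i, f i : Lp ℝ 2 μ) =ᵐ[μ] fun x => ∑ i, f i x := by
  simp only [Fin.sum_univ_two]
  exact Lp.coeFn_add _ _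

theorem coeFn_shearStrainL2 (a : PlateState Ω) (i : Fin 2) :
    shearStrainL2 a i =ᵐ[volume.restrict Ω] shearStrain a i :=
  Lp.coeFn_sub (a.w.partial i) (a.φ i).val

theorem coeFn_symGradL2 (φ : Fin 2 → H1 Ω) (i j : Fin 2) :
    symGradL2 φ i j =ᵐ[volume.restrict Ω] symGrad φ i j := by
  filter_upwards [Lp.coeFn_smul (1 / 2 : ℝ) ((φ j).partial i + (φ i).partial j),
    Lp.coeFn_add ((φ j).partial i) ((φ i).partial j)] with x h1 h2
  rw [symGradL2, h1, Pi.smul_apply, h2, Pi.add_apply, symGrad, smul_eq_mul]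
  ring

theorem coeFn_shearForceL2 (P : PlateParameters Ω) (hΩ : IsOpen Ω) (a : PlateState Ω)
    (i : Fin 2) : shearForceL2 P hΩ a i =ᵐ[volume.restrict Ω] shearForce P a i := by
  filter_upwards [coeFn_mulLp (P.isEssBounded_shear hΩ) (shearStrainL2 a i),
    coeFn_shearStrainL2 a i] with x h1 h2
  rw [shearForceL2, h1, h2, shearForce]

theorem coeFn_stiffnessL2 (P : PlateParameters Ω) (hΩ : IsOpen Ω) (a : PlateState Ω)
    (i j : Fin 2) :
    stiffnessL2 P hΩ (symGradL2 a.φ) i j =ᵐ[volume.restrict Ω] bendingMoment P a i j := by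
  have h1 : ∀ᵐ x ∂volume.restrict Ω, ∀ l,
      (∑ m, mulLp (P.isEssBounded_stiffness hΩ i j l m) (symGradL2 a.φ l m) : L2 Ω) x =
        ∑ m, mulLp (P.isEssBounded_stiffness hΩ i j l m) (symGradL2 a.φ l m) x :=
    ae_all_iff.2 fun l => coeFn_sum_two _
  have h2 : ∀ᵐ x ∂volume.restrict Ω, ∀ l m,
      mulLp (P.isEssBounded_stiffness hΩ i j l m) (symGradL2 a.φ l m) x =
        P.D x i j l m * symGradL2 a.φ l m x :=
    ae_all_iff.2 fun l => ae_all_iff.2 fun m => coeFn_mulLp _ _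
  have h3 : ∀ᵐ x ∂volume.restrict Ω, ∀ l m, symGradL2 a.φ l m x = symGrad a.φ l m x :=
    ae_all_iff.2 fun l => ae_all_iff.2 fun m => coeFn_symGradL2 _ l m
  filter_upwards [h1, h2, h3, coeFn_sum_two fun l =>
    ∑ m, mulLp (P.isEssBounded_stiffness hΩ i j l m) (symGradL2 a.φ l m)] with x h1 h2 h3 h4
  rw [stiffnessL2, h4, bendingMoment]
  simp only [h1, h2, h3]

theorem mulLp_congr {α : Type*} {mα : MeasurableSpace α} {μ : Measure α} {c d : α → ℝ}
    (hc : IsEssBounded μ c) (hd : IsEssBounded μ d) (h : c =ᵐ[μ] d) (f : Lp ℝ 2 μ) :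
    mulLp hc f = mulLp hd f := by
  refine Lp.ext ?_
  filter_upwards [coeFn_mulLp hc f, coeFn_mulLp hd f, h] with x h1 h2 h3
  rw [h1, h2, h3]

theorem inner_stiffness_symm (P : PlateParameters Ω) (hΩ : IsOpen Ω) (i j l m : Fin 2)
    (f g : L2 Ω) :
    inner ℝ f (mulLp (P.isEssBounded_stiffness hΩ i j l m) g) =
      inner ℝ g (mulLp (P.isEssBounded_stiffness hΩ l m i j) f) := by
  rw [← inner_mulLp_left, real_inner_comm]
  congr 1
  refine mulLp_congr _ _ ?_ f
  filter_upwards [ae_restrict_mem hΩ.measurableSet] with x hx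
  exact P.D_major x hx i j l m

theorem sum_inner_stiffnessL2_symm (P : PlateParameters Ω) (hΩ : IsOpen Ω)
    (E F : Fin 2 → Fin 2 → L2 Ω) :
    ∑ i, ∑ j, inner ℝ (E i j) (stiffnessL2 P hΩ F i j) =
      ∑ i, ∑ j, inner ℝ (F i j) (stiffnessL2 P hΩ E i j) := by
  have h : ∀ i j l m, inner ℝ (E i j) (mulLp (P.isEssBounded_stiffness hΩ i j l m) (F l m)) =
      inner ℝ (F l m) (mulLp (P.isEssBounded_stiffness hΩ l m i j) (E i j)) :=
    fun i j l m => inner_stiffness_symm P hΩ i j l m _ _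
  simp only [stiffnessL2, Fin.sum_univ_two, inner_add_right, h]
  ring

theorem stiffnessL2_swap (P : PlateParameters Ω) (hΩ : IsOpen Ω) (E : Fin 2 → Fin 2 → L2 Ω)
    (i j : Fin 2) : stiffnessL2 P hΩ E i j = stiffnessL2 P hΩ E j i := by
  refine Finset.sum_congr rfl fun l _ => Finset.sum_congr rfl fun m _ => mulLp_congr _ _ ?_ _
  filter_upwards [ae_restrict_mem hΩ.measurableSet] with x hx
  exact P.D_minor x hx i j l m

/-- Replaces the integral by L² inner products of bounded operators, which can be differentiated in
time without differentiating under an integral. -/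
theorem hamiltonian_eq (P : PlateParameters Ω) (hΩ : IsOpen Ω) (a : PlateState Ω) :
    hamiltonian P a = (1 / 2) *
      (inner ℝ (mulLp (P.isEssBounded_momentum hΩ) a.pw) a.pw
        + ∑ i, inner ℝ (mulLp (P.isEssBounded_angular hΩ) (a.pφ i)) (a.pφ i)
        + ∑ i, inner ℝ (shearForceL2 P hΩ a i) (shearStrainL2 a i)
        + ∑ i, ∑ j, inner ℝ (symGradL2 a.φ i j) (stiffnessL2 P hΩ (symGradL2 a.φ) i j)) := by
  have h1 := coeFn_mulLp (P.isEssBounded_momentum hΩ) a.pw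
  have h2 : ∀ᵐ x ∂volume.restrict Ω, ∀ i, mulLp (P.isEssBounded_angular hΩ) (a.pφ i) x = _ :=
    ae_all_iff.2 fun i => coeFn_mulLp (P.isEssBounded_angular hΩ) (a.pφ i)
  have h3 : ∀ᵐ x ∂volume.restrict Ω, ∀ i, shearForceL2 P hΩ a i x = shearForce P a i x :=
    ae_all_iff.2 fun i => coeFn_shearForceL2 P hΩ a i
  have h4 : ∀ᵐ x ∂volume.restrict Ω, ∀ i, shearStrainL2 a i x = shearStrain a i x :=
    ae_all_iff.2 fun i => coeFn_shearStrainL2 a i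
  have h5 : ∀ᵐ x ∂volume.restrict Ω, ∀ i j, symGradL2 a.φ i j x = symGrad a.φ i j x :=
    ae_all_iff.2 fun i => ae_all_iff.2 fun j => coeFn_symGradL2 _ i j
  have h6 : ∀ᵐ x ∂volume.restrict Ω, ∀ i j,
      stiffnessL2 P hΩ (symGradL2 a.φ) i j x = bendingMoment P a i j x :=
    ae_all_iff.2 fun i => ae_all_iff.2 fun j => coeFn_stiffnessL2 P hΩ a i j
  have i2 := fun i (_ : i ∈ Finset.univ) =>
    L2_integrable_mul (mulLp (P.isEssBounded_angular hΩ) (a.pφ i)) (a.pφ i)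
  have i3 := fun i (_ : i ∈ Finset.univ) =>
    L2_integrable_mul (shearForceL2 P hΩ a i) (shearStrainL2 a i)
  have i4 := fun i j (_ : j ∈ Finset.univ) =>
    L2_integrable_mul (symGradL2 a.φ i j) (stiffnessL2 P hΩ (symGradL2 a.φ) i j)
  have i1 := L2_integrable_mul (mulLp (P.isEssBounded_momentum hΩ) a.pw) a.pw
  have j4 := fun i (_ : i ∈ Finset.univ) => integrable_finsetSum Finset.univ (i4 i)
  simp only [L2_inner_eq]
  simp only [← integral_finsetSum Finset.univ (i4 _)]
  rw [← integral_finsetSum Finset.univ i2, ← integral_finsetSum Finset.univ i3,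
    ← integral_finsetSum Finset.univ j4,
    ← integral_add' i1 (integrable_finsetSum _ i2),
    ← integral_add' (i1.add (integrable_finsetSum _ i2)) (integrable_finsetSum _ i3),
    ← integral_add' ((i1.add (integrable_finsetSum _ i2)).add (integrable_finsetSum _ i3))
      (integrable_finsetSum _ j4), hamiltonian]
  congr 1
  refine integral_congr_ae ?_
  filter_upwards [h1, h2, h3, h4, h5, h6] with x h1 h2 h3 h4 h5 h6
  simp only [h1, h2, h3, h4, h5, h6, Fin.sum_univ_two, shearForce, Pi.add_apply]
  simp only [div_eq_mul_inv, mul_inv]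
  ring

/-- The polar form of the Hamiltonian: its derivative at `a` in the direction `v`. -/
noncomputable def energyPairing (P : PlateParameters Ω) (hΩ : IsOpen Ω) (a v : PlateState Ω) : ℝ :=
  inner ℝ (mulLp (P.isEssBounded_momentum hΩ) a.pw) v.pw
    + ∑ i, inner ℝ (mulLp (P.isEssBounded_angular hΩ) (a.pφ i)) (v.pφ i)
    + ∑ i, inner ℝ (shearForceL2 P hΩ a i) (shearStrainL2 v i)
    + ∑ i, ∑ j, inner ℝ (symGradL2 v.φ i j) (stiffnessL2 P hΩ (symGradL2 a.φ) i j)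

/-- Multiplication is self-adjoint on L², hence the factor 2. -/
theorem hasDerivWithinAt_inner_mulLp {α : Type*} {mα : MeasurableSpace α} {μ : Measure α}
    {c : α → ℝ} (hc : IsEssBounded μ c) {b : ℝ → Lp ℝ 2 μ} {b' : Lp ℝ 2 μ} {I : Set ℝ} {t : ℝ}
    (hb : HasDerivWithinAt b b' I t) :
    HasDerivWithinAt (fun s => inner ℝ (mulLp hc (b s)) (b s)) (2 * inner ℝ (mulLp hc (b t)) b')
      I t := by
  have h1 : HasDerivWithinAt (fun s => mulLp hc (b s)) (mulLp hc b') I t :=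
    (mulLp hc).hasFDerivAt.comp_hasDerivWithinAt t hb
  refine (h1.inner ℝ hb).congr_deriv ?_
  rw [inner_mulLp_left hc b', real_inner_comm b']
  ring

theorem HasTimeDerivWithinAt.shearStrainL2 {a : ℝ → PlateState Ω} {v : PlateState Ω} {I : Set ℝ}
    {t : ℝ} (h : HasTimeDerivWithinAt a v I t) (i : Fin 2) :
    HasDerivWithinAt (fun s => ReissnerMindlin.shearStrainL2 (a s) i)
      (ReissnerMindlin.shearStrainL2 v i) I t :=
  ((partialCLM Ω i).hasFDerivAt.comp_hasDerivWithinAt t h.w).sub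
    ((valCLM Ω).hasFDerivAt.comp_hasDerivWithinAt t (hasDerivWithinAt_pi.1 h.φ i))

theorem HasTimeDerivWithinAt.symGradL2 {a : ℝ → PlateState Ω} {v : PlateState Ω} {I : Set ℝ}
    {t : ℝ} (h : HasTimeDerivWithinAt a v I t) (i j : Fin 2) :
    HasDerivWithinAt (fun s => ReissnerMindlin.symGradL2 (a s).φ i j)
      (ReissnerMindlin.symGradL2 v.φ i j) I t :=
  (((partialCLM Ω i).hasFDerivAt.comp_hasDerivWithinAt t (hasDerivWithinAt_pi.1 h.φ j)).add
    ((partialCLM Ω j).hasFDerivAt.comp_hasDerivWithinAt t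
      (hasDerivWithinAt_pi.1 h.φ i))).const_smul (1 / 2 : ℝ)

theorem hasDerivWithinAt_stiffnessL2 (P : PlateParameters Ω) (hΩ : IsOpen Ω)
    {E : ℝ → Fin 2 → Fin 2 → L2 Ω} {E' : Fin 2 → Fin 2 → L2 Ω} {I : Set ℝ} {t : ℝ}
    (h : ∀ i j, HasDerivWithinAt (fun s => E s i j) (E' i j) I t) (i j : Fin 2) :
    HasDerivWithinAt (fun s => stiffnessL2 P hΩ (E s) i j) (stiffnessL2 P hΩ E' i j) I t :=
  HasDerivWithinAt.fun_sum fun l _ => HasDerivWithinAt.fun_sum fun m _ =>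
    (mulLp (P.isEssBounded_stiffness hΩ i j l m)).hasFDerivAt.comp_hasDerivWithinAt t (h l m)

/-- The Hamiltonian is differentiable along differentiable trajectories. -/
theorem HasTimeDerivWithinAt.hamiltonian (P : PlateParameters Ω) (hΩ : IsOpen Ω)
    {a : ℝ → PlateState Ω} {v : PlateState Ω} {I : Set ℝ} {t : ℝ}
    (h : HasTimeDerivWithinAt a v I t) :
    HasDerivWithinAt (fun s => ReissnerMindlin.hamiltonian P (a s))
      (energyPairing P hΩ (a t) v) I t := by
  simp only [hamiltonian_eq P hΩ]
  have h1 := hasDerivWithinAt_inner_mulLp (P.isEssBounded_momentum hΩ) h.pw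
  have h2 := HasDerivWithinAt.fun_sum (u := Finset.univ) fun i _ =>
    hasDerivWithinAt_inner_mulLp (P.isEssBounded_angular hΩ) (hasDerivWithinAt_pi.1 h.pφ i)
  have h3 := HasDerivWithinAt.fun_sum (u := Finset.univ) fun i _ =>
    hasDerivWithinAt_inner_mulLp (P.isEssBounded_shear hΩ) (h.shearStrainL2 i)
  have h4 := HasDerivWithinAt.fun_sum (u := Finset.univ) fun i _ =>
    HasDerivWithinAt.fun_sum (u := Finset.univ) fun j _ =>
      (h.symGradL2 i j).inner ℝ (hasDerivWithinAt_stiffnessL2 P hΩ h.symGradL2 i j)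
  refine ((((h1.fun_add h2).fun_add h3).fun_add h4).const_mul (1 / 2)).congr_deriv ?_
  -- Major symmetry identifies the two halves of the derivative of the bending energy; the prefactor
  -- 1/2 then cancels.
  simp only [Finset.sum_add_distrib, sum_inner_stiffnessL2_symm P hΩ
    (ReissnerMindlin.symGradL2 (a t).φ) (ReissnerMindlin.symGradL2 v.φ), ← Finset.mul_sum,
    energyPairing, shearForceL2]
  ring

/-! ### The equations of motion -/

/-- An element of `L²(Ω)` is determined by its inner products with test functions. -/
theorem L2_ext_of_test (h : HasBoundaryCalculus Ω) {u u' : L2 Ω}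
    (huu : ∀ (f : H1 Ω) (η : Plane → ℝ), ContDiff ℝ ∞ η → HasCompactSupport η →
      tsupport η ⊆ Ω → IsJetOf Ω f η → inner ℝ u f.val = inner ℝ u' f.val) : u = u' := by
  rw [← sub_eq_zero]
  have hfin : IsFiniteMeasure ((volume : Measure Plane).restrict Ω) :=
    ⟨by simpa using h.bounded.measure_lt_top⟩
  have hloc : LocallyIntegrableOn (u - u' : L2 Ω) Ω volume :=
    IntegrableOn.locallyIntegrableOn ((Lp.memLp (u - u')).integrable one_le_two)
  -- The fundamental lemma of the calculus of variations.
  have h0 := h.isOpen.ae_eq_zero_of_integral_contDiff_smul_eq_zero hloc ?_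
  · refine Lp.ext ?_
    filter_upwards [(ae_restrict_iff' h.isOpen.measurableSet).2 h0, Lp.coeFn_zero ℝ 2
      (volume.restrict Ω)] with x h1 h2
    rw [h1, h2, Pi.zero_apply]
  · intro η hη hc hs
    obtain ⟨f, hf⟩ := h.exists_isJetOf hη
    have e1 : inner ℝ (u - u') f.val = 0 := by
      rw [inner_sub_left, huu f η hη hc hs hf, sub_self]
    rw [L2_inner_eq] at e1
    rw [← setIntegral_eq_integral_of_forall_compl_eq_zero (s := Ω), ← e1]
    · refine integral_congr_ae ?_
      filter_upwards [hf.1] with x hx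
      rw [H1.val, hx, smul_eq_mul, mul_comm]
    · intro x hx
      rw [image_eq_zero_of_notMem_tsupport fun h' => hx (hs h'), zero_smul]

/-- Integration by parts against a test function. -/
theorem inner_partial_test (h : HasBoundaryCalculus Ω) (u : H1 Ω) {f : H1 Ω} {η : Plane → ℝ}
    (hη : ContDiff ℝ ∞ η) (hs : tsupport η ⊆ Ω) (hf : IsJetOf Ω f η) (i : Fin 2) :
    inner ℝ u.val (f.partial i) = -inner ℝ (u.partial i) f.val := by
  -- The support lies in Ω, away from the frontier, so Green's formula loses its boundary term.
  have h0 : trace f = 0 := by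
    refine Lp.ext ?_
    filter_upwards [h.trace_of_isJetOf hη hf, Lp.coeFn_zero ℝ 2 (boundaryMeasure Ω),
      ae_restrict_mem isClosed_frontier.measurableSet] with x h1 h2 h3
    rw [h1, h2, Pi.zero_apply]
    refine image_eq_zero_of_notMem_tsupport fun h' => ?_
    have : x ∈ Ω ∩ frontier Ω := ⟨hs h', h3⟩
    rwa [h.isOpen.inter_frontier_eq] at this
  have := green h u f i
  rw [h0, map_zero, inner_zero_right] at this
  linarith

theorem isTestFunction_zero : IsTestFunction (0 : L2 Ω) :=
  ⟨0, contDiff_const, HasCompactSupport.zero, by simp, Lp.coeFn_zero ℝ 2 _⟩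

theorem IsShearForce.val_eq {P : PlateParameters Ω} {a : PlateState Ω} {N : Fin 2 → H1 Ω}
    (hN : IsShearForce P a N) (hΩ : IsOpen Ω) (i : Fin 2) : shearForceL2 P hΩ a i = (N i).val :=
  Lp.ext ((coeFn_shearForceL2 P hΩ a i).trans (hN i).symm)

theorem IsBendingMoment.val_eq {P : PlateParameters Ω} {a : PlateState Ω}
    {M : Fin 2 → Fin 2 → H1 Ω} (hM : IsBendingMoment P a M) (hΩ : IsOpen Ω) (i j : Fin 2) :
    stiffnessL2 P hΩ (symGradL2 a.φ) i j = (M i j).val :=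
  Lp.ext ((coeFn_stiffnessL2 P hΩ a i j).trans (hM i j).symm)

/-- Minor symmetry makes the bending moment symmetric, so pairing it with the symmetric gradient is
the same as pairing it with the full gradient. -/
theorem energyPairing_eq {P : PlateParameters Ω} (hΩ : IsOpen Ω) {a : PlateState Ω}
    {N : Fin 2 → H1 Ω} (hN : IsShearForce P a N) {M : Fin 2 → Fin 2 → H1 Ω}
    (hM : IsBendingMoment P a M) (v : PlateState Ω) :
    energyPairing P hΩ a v =
      inner ℝ (mulLp (P.isEssBounded_momentum hΩ) a.pw) v.pw
        + ∑ i, inner ℝ (mulLp (P.isEssBounded_angular hΩ) (a.pφ i)) (v.pφ i)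
        + ∑ i, (inner ℝ (N i).val (v.w.partial i) - inner ℝ (N i).val (v.φ i).val)
        + ∑ i, ∑ j, inner ℝ (M i j).val ((v.φ i).partial j) := by
  have hsymm : (M 1 0).val = (M 0 1).val := by
    rw [← hM.val_eq hΩ, ← hM.val_eq hΩ, stiffnessL2_swap]
  simp only [energyPairing, hN.val_eq hΩ, hM.val_eq hΩ, shearStrainL2, symGradL2,
    inner_sub_right, inner_smul_left, inner_add_left, Fin.sum_univ_two, hsymm]
  simp only [real_inner_comm (M 0 0).val, real_inner_comm (M 0 1).val,
    real_inner_comm (M 1 1).val, one_div, map_inv₀, map_ofNat]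
  ring

/-- A variation of one component is a trajectory of constant velocity, so the chain rule for the
Hamiltonian along trajectories also computes its directional derivatives. -/
theorem hasTimeDerivWithinAt_line_w (a : PlateState Ω) (f : H1 Ω) :
    HasTimeDerivWithinAt (fun s : ℝ => { a with w := a.w + s • f }) ⟨f, 0, 0, 0⟩ univ 0 where
  w := by
    simpa using (((hasDerivAt_id (0 : ℝ)).smul_const f).const_add a.w)
  pw := hasDerivWithinAt_const _ _ _
  φ := hasDerivWithinAt_const _ _ _
  pφ := hasDerivWithinAt_const _ _ _

theorem hasTimeDerivWithinAt_line_pw (a : PlateState Ω) (f : L2 Ω) :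
    HasTimeDerivWithinAt (fun s : ℝ => { a with pw := a.pw + s • f }) ⟨0, f, 0, 0⟩ univ 0 where
  w := hasDerivWithinAt_const _ _ _
  pw := by
    simpa using (((hasDerivAt_id (0 : ℝ)).smul_const f).const_add a.pw)
  φ := hasDerivWithinAt_const _ _ _
  pφ := hasDerivWithinAt_const _ _ _

theorem hasTimeDerivWithinAt_line_φ (a : PlateState Ω) (f : Fin 2 → H1 Ω) :
    HasTimeDerivWithinAt (fun s : ℝ => { a with φ := a.φ + s • f }) ⟨0, 0, f, 0⟩ univ 0 where
  w := hasDerivWithinAt_const _ _ _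
  pw := hasDerivWithinAt_const _ _ _
  φ := by
    simpa using (((hasDerivAt_id (0 : ℝ)).smul_const f).const_add a.φ)
  pφ := hasDerivWithinAt_const _ _ _

theorem hasTimeDerivWithinAt_line_pφ (a : PlateState Ω) (f : Fin 2 → L2 Ω) :
    HasTimeDerivWithinAt (fun s : ℝ => { a with pφ := a.pφ + s • f }) ⟨0, 0, 0, f⟩ univ 0 where
  w := hasDerivWithinAt_const _ _ _
  pw := hasDerivWithinAt_const _ _ _
  φ := hasDerivWithinAt_const _ _ _
  pφ := by
    simpa using (((hasDerivAt_id (0 : ℝ)).smul_const f).const_add a.pφ)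

@[simp] theorem H1.val_zero : (0 : H1 Ω).val = 0 := rfl

@[simp] theorem H1.partial_zero (i : Fin 2) : (0 : H1 Ω).partial i = 0 := rfl

section VariationalDerivative

variable {P : PlateParameters Ω} {a : PlateState Ω} {e : PlateEffort Ω}

/-- If `H` has the derivative `d` along a line, then `d` is the energy pairing of the direction. -/
theorem eq_energyPairing_of_hasDerivAt (hΩ : IsOpen Ω) {b : ℝ → PlateState Ω} {v : PlateState Ω}
    (hb : HasTimeDerivWithinAt b v univ 0) (hb0 : b 0 = a) {d : ℝ}
    (hd : HasDerivAt (fun s => hamiltonian P (b s)) d 0) : d = energyPairing P hΩ a v := by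
  rw [← hb0]
  exact hd.unique (hasDerivWithinAt_univ.1 (hb.hamiltonian P hΩ))

variable {N : Fin 2 → H1 Ω} {M : Fin 2 → Fin 2 → H1 Ω}

theorem IsVariationalDerivative.pw_eq (h : HasBoundaryCalculus Ω)
    (he : IsVariationalDerivative (hamiltonian P) a e) :
    e.pw = mulLp (P.isEssBounded_momentum h.isOpen) a.pw := by
  refine L2_ext_of_test h fun f η hη hc hs hf => ?_
  rw [eq_energyPairing_of_hasDerivAt (a := a) h.isOpen (hasTimeDerivWithinAt_line_pw a f.val)
    (by simp)
    (he.pw f.val ⟨η, hη, hc, hs, hf.1⟩)]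
  simp [energyPairing, shearStrainL2, symGradL2]

theorem IsVariationalDerivative.pφ_eq (h : HasBoundaryCalculus Ω)
    (he : IsVariationalDerivative (hamiltonian P) a e) (k : Fin 2) :
    e.pφ k = mulLp (P.isEssBounded_angular h.isOpen) (a.pφ k) := by
  refine L2_ext_of_test h fun f η hη hc hs hf => ?_
  have hv := eq_energyPairing_of_hasDerivAt (a := a) h.isOpen
    (hasTimeDerivWithinAt_line_pφ a (Pi.single k f.val)) (by simp)
    (he.pφ (Pi.single k f.val) fun i => ?_)
  · simpa [energyPairing, shearStrainL2, symGradL2, Pi.single_apply, apply_ite] using hv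
  · rcases eq_or_ne i k with rfl | hik
    · rw [Pi.single_eq_same]
      exact ⟨η, hη, hc, hs, hf.1⟩
    · simpa [hik] using isTestFunction_zero

/-- Only the shear energy depends on w; integrating by parts against a test function moves the
gradient onto N. -/
theorem IsVariationalDerivative.w_eq (h : HasBoundaryCalculus Ω)
    (he : IsVariationalDerivative (hamiltonian P) a e) (hN : IsShearForce P a N)
    (hM : IsBendingMoment P a M) : e.w = -∑ i, (N i).partial i := by
  refine L2_ext_of_test h fun f η hη hc hs hf => ?_
  rw [eq_energyPairing_of_hasDerivAt (a := a) h.isOpen (hasTimeDerivWithinAt_line_w a f) (by simp)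
    (he.w f ⟨η, hη, hc, hs, hf.1⟩), energyPairing_eq h.isOpen hN hM]
  simp [inner_partial_test h _ hη hs hf, inner_neg_left, inner_add_left, Fin.sum_univ_two]

/-- The rotation enters the shear energy undifferentiated, which gives N, and the bending energy
through its gradient, which gives Div M after integration by parts. -/
theorem IsVariationalDerivative.φ_eq (h : HasBoundaryCalculus Ω)
    (he : IsVariationalDerivative (hamiltonian P) a e) (hN : IsShearForce P a N)
    (hM : IsBendingMoment P a M) (k : Fin 2) :
    e.φ k = -((N k).val + ∑ j, (M k j).partial j) := by
  refine L2_ext_of_test h fun f η hη hc hs hf => ?_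
  -- Only the k-th rotation varies; the other component of the variation is zero, itself a test
  -- function.
  have hv := eq_energyPairing_of_hasDerivAt (a := a) h.isOpen
    (hasTimeDerivWithinAt_line_φ a (Pi.single k f)) (by simp)
    (he.φ (Pi.single k f) fun i => ?_)
  · rw [energyPairing_eq h.isOpen hN hM] at hv
    have hz : ∀ i j, inner ℝ (M i j).val ((Pi.single k f : Fin 2 → H1 Ω) i |>.partial j) =
        if i = k then -inner ℝ ((M i j).partial j) f.val else 0 := by
      intro i j
      split_ifs with hik
      · subst hik
        rw [Pi.single_eq_same, inner_partial_test h _ hη hs hf]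
      · rw [Pi.single_eq_of_ne hik, H1.partial_zero, inner_zero_right]
    have hz' : ∀ u : Fin 2 → L2 Ω, ∑ i, inner ℝ (u i) ((Pi.single k f : Fin 2 → H1 Ω) i).val =
        inner ℝ (u k) f.val := by
      intro u
      rw [Finset.sum_eq_single k]
      · rw [Pi.single_eq_same]
      · intro i _ hik
        rw [Pi.single_eq_of_ne hik, H1.val_zero, inner_zero_right]
      · simp
    simp only [Finset.sum_sub_distrib, hz, hz'] at hv
    rw [hv]
    simp [inner_neg_left, inner_add_left]
    ring
  · rcases eq_or_ne i k with rfl | hik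
    · rw [Pi.single_eq_same]
      exact ⟨η, hη, hc, hs, hf.1⟩
    · simpa [hik] using isTestFunction_zero

end VariationalDerivative

/-! ### The power balance at a fixed time -/

/-- The boundary power `∫ τ σ nᵢ` as an inner product. -/
theorem integral_mul_normal (h : HasBoundaryCalculus Ω) (τ σ : L2Boundary Ω) (i : Fin 2) :
    Integrable (fun x => τ x * (σ x * outwardNormal Ω x i)) (boundaryMeasure Ω) ∧
      ∫ x, τ x * (σ x * outwardNormal Ω x i) ∂boundaryMeasure Ω =
        inner ℝ τ (mulLp (h.isEssBounded_normal i) σ) := by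
  have he : (fun x => τ x * mulLp (h.isEssBounded_normal i) σ x) =ᵐ[boundaryMeasure Ω]
      fun x => τ x * (σ x * outwardNormal Ω x i) := by
    filter_upwards [coeFn_mulLp (h.isEssBounded_normal i) σ] with x hx
    rw [hx, mul_comm (σ x)]
  rw [L2_inner_eq]
  exact ⟨(L2_integrable_mul _ _).congr he, (integral_congr_ae he).symm⟩

/-- Green's formula summed over the coordinates: the right side is ⟨u, div F⟩ + ⟨grad u, F⟩. -/
theorem integral_mul_normalTrace (h : HasBoundaryCalculus Ω) (u : H1 Ω) (F : Fin 2 → H1 Ω) :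
    Integrable (fun x => trace u x * normalTrace F x) (boundaryMeasure Ω) ∧
      ∫ x, trace u x * normalTrace F x ∂boundaryMeasure Ω =
        ∑ i, (inner ℝ u.val ((F i).partial i) + inner ℝ (u.partial i) (F i).val) := by
  have hi := fun i (_ : i ∈ Finset.univ) => (integral_mul_normal h (trace u) (trace (F i)) i).1
  simp only [normalTrace, Finset.mul_sum]
  refine ⟨integrable_finsetSum _ hi, ?_⟩
  rw [integral_finsetSum _ hi]
  exact Finset.sum_congr rfl fun i _ =>
    ((integral_mul_normal h (trace u) (trace (F i)) i).2.trans (green h u (F i) i).symm)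

/-- The power balance at a state `a` with velocity `v`. -/
theorem energyPairing_eq_boundary (h : HasBoundaryCalculus Ω) {P : PlateParameters Ω}
    {a v : PlateState Ω} {e : PlateEffort Ω} (he : IsVariationalDerivative (hamiltonian P) a e)
    (hv : IsStructureRelation v e) {N : Fin 2 → H1 Ω} (hN : IsShearForce P a N)
    {M : Fin 2 → Fin 2 → H1 Ω} (hM : IsBendingMoment P a M) :
    energyPairing P h.isOpen a v =
      ∫ x, (trace v.w x * normalTrace N x
        + ∑ i, trace (v.φ i) x * normalTrace (M i) x) ∂(boundaryMeasure Ω) := by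
  have hi := fun i (_ : i ∈ Finset.univ) => (integral_mul_normalTrace h (v.φ i) (M i)).1
  rw [integral_add (integral_mul_normalTrace h v.w N).1 (integrable_finsetSum _ hi),
    integral_finsetSum _ hi, (integral_mul_normalTrace h v.w N).2]
  simp only [(integral_mul_normalTrace h (v.φ _) (M _)).2]
  -- By the equations of motion the momentum terms become ⟨∂ₜw, div N⟩ and ⟨∂ₜφ, N + Div M⟩. The
  -- pairing of ∂ₜφ with N cancels the one from the shear energy, leaving exactly the sums in
  -- Green's formula.
  rw [energyPairing_eq h.isOpen hN hM, ← he.pw_eq h, ← hv.w, hv.pw, he.w_eq h hN hM]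
  simp only [← he.pφ_eq h, ← hv.φ, hv.pφ, he.φ_eq h hN hM, neg_neg, inner_add_right, inner_sum,
    Finset.sum_add_distrib, Finset.sum_sub_distrib]
  simp only [real_inner_comm (N _).val, real_inner_comm (M _ _).val]
  ring

end ReissnerMindlin

open ReissnerMindlin
theorem mainTheorem6 (Ω : Set Plane) (hΩ_open : IsOpen Ω) (hΩ_bdd : Bornology.IsBounded Ω)
    (hΩ_lip : HasLipschitzBoundary Ω) (P : PlateParameters Ω) (I : Set ℝ)
    (a adot : ℝ → PlateState Ω) (hsol : IsSolution P I a adot)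
    (N : ℝ → Fin 2 → H1 Ω) (hN : ∀ t ∈ I, IsShearForce P (a t) (N t))
    (M : ℝ → Fin 2 → Fin 2 → H1 Ω) (hM : ∀ t ∈ I, IsBendingMoment P (a t) (M t)) :
    ∀ t ∈ I,
      HasDerivWithinAt (fun s => portDisplacement (a s)) (portDisplacement (adot t)) I t ∧
      Integrable (fun x => trace (adot t).w x * normalTrace (N t) x
        + ∑ i, trace ((adot t).φ i) x * normalTrace (M t i) x) (boundaryMeasure Ω) ∧
      HasDerivWithinAt (fun s => hamiltonian P (a s))
        (∫ x, (trace (adot t).w x * normalTrace (N t) x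
          + ∑ i, trace ((adot t).φ i) x * normalTrace (M t i) x) ∂(boundaryMeasure Ω)) I t := by
  intro t ht
  have h := hΩ_lip.hasBoundaryCalculus hΩ_open hΩ_bdd
  obtain ⟨hd, e, he, hv⟩ := hsol t ht
  refine ⟨?_, ?_, ?_⟩
  -- A continuous linear trace commutes with the time derivative, component by component.
  · have h1 := h.traceCLM.hasFDerivAt.comp_hasDerivWithinAt t hd.w
    have h2 := fun i =>
      h.traceCLM.hasFDerivAt.comp_hasDerivWithinAt t (hasDerivWithinAt_pi.1 hd.φ i)
    have h3 := h1.prodMk (hasDerivWithinAt_pi.2 h2)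
    simpa only [portDisplacement, ← h.traceCLM_apply, Function.comp_def] using h3
  · exact (integral_mul_normalTrace h _ _).1.add
      (integrable_finsetSum _ fun i _ => (integral_mul_normalTrace h _ _).1)
  · rw [← energyPairing_eq_boundary h he hv (hN t ht) (hM t ht)]
    exact hd.hamiltonian P h.isOpen
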